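/- **Definitions.** A metric space $(X,d)$ has *negative type* if $\sum_{i,j=1}^n\alpha_i\alpha_j\,d(x_i,x_j)\le 0$ for all $n$, all $x_1,\dots,x_n\in X$ and all $\alpha_1,\dots,\alpha_n\in\mathbb{R}$ with $\sum_i\alpha_i=0$. It has *strong negative type* if it has negative type and, for all Borel probability measures $\mu_1,\mu_2$ on $X$ with finite first moment, $$\int d(x,x')\,d(\mu_1-\mu_2)^2(x,x')\le 0,\quad\text{with equality only if }\mu_1=\mu_2 .$$ Fix a field of coefficients. For a filtration $(K_a)_{a\in\mathbb{R}}$ of simplicial complexes ($K_a\subseteq K_b$ for $a\le b$) and a homology degree $n$, let $\beta^{a,b}=\dim Z_n(K_a)/(B_n(K_b)\cap Z_n(K_a))$. The *persistence landscape* of the filtration is the sequence of functions $$\lambda_k(t)=\sup\{m\ge 0 \mid \beta^{t-m,t+m}\ge k\}\in[0,\infty],\qquad k=1,2,\dots,\ t\in\mathbb{R},\quad \sup\emptyset=0 .$$ For $1\le p\le\infty$, the $L^p$ norm is $\|\lambda\|_p=\big(\sum_{k\ge 1}\|\lambda_k\|_p^p\big)^{1/p}$ if $p<\infty$, and $\|\lambda\|_\infty=\sup_k\|\lambda_k\|_\infty$.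 Let $L^p(\mathbb{N}\times\mathbb{R})$ be the space of (classes of) functions with finite norm, let $\Lambda_p\subseteq L^p(\mathbb{N}\times\mathbb{R})$ be the set of its elements that are persistence landscapes of filtrations, and let $\Lambda_p^{\mathrm{diag}}\subseteq\Lambda_p$ be the set of those that arise from persistence diagrams: the filtration is one of complexes on a finite vertex set, and there is a finite multiset of bars $[b,d)$, $b<d$ real, such that for all $a\le c$ the number $\beta^{a,c}$ is the number of bars containing both $a$ and $c$. All these sets carry the metric of the $L^p$ norm. **Theorem.** The following hold for the space of persistence landscapes, understood either as the function space $L^p(\mathbb{N}\times\mathbb{R})$ or as its subset $\Lambda_p$. (a) For $p=2$ it is of strong negative type. (b) For $1\le p\le 2$ it is of negative type. (c) For $p=1$ it is not of strong negative type, even when restricting to $\Lambda_1^{\mathrm{diag}}$. (d) For $p=\infty$ it is not of negative type, even when restricting to $\Lambda_\infty^{\mathrm{diag}}$. -/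

import Mathlib

open MeasureTheory
open scoped ENNReal NNReal

noncomputable section

/-! ### Metric spaces of negative type and of strong negative type -/

/-- A metric space has negative type if `∑ i, j, α i * α j * d (x i, x j) ≤ 0` for all finite families
of points and all real weights of total sum zero. -/
def NegativeType (X : Type*) [MetricSpace X] : Prop :=
  ∀ (n : ℕ) (x : Fin n → X) (α : Fin n → ℝ), ∑ i, α i = 0 →
    ∑ i, ∑ j, α i * α j * dist (x i) (x j) ≤ 0

/-- A measure on a metric space has finite first moment if the expected distance to each point is
finite. -/
def FiniteFirstMoment {X : Type*} [MetricSpace X] [MeasurableSpace X] (μ : Measure X) : Prop :=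
  ∀ x : X, Integrable (fun y => dist x y) μ

/-- `∫ d(x, x') d(μ - ν)²(x, x')`, with the square of the signed measure `μ - ν` expanded. All the
integrands are integrable (and continuous in each variable) when `μ` and `ν` are probability
measures with finite first moment. -/
def energyIntegral {X : Type*} [MetricSpace X] [MeasurableSpace X] (μ ν : Measure X) : ℝ :=
  (∫ x, ∫ y, dist x y ∂μ ∂μ) - (∫ x, ∫ y, dist x y ∂ν ∂μ)
    - (∫ x, ∫ y, dist x y ∂μ ∂ν) + (∫ x, ∫ y, dist x y ∂ν ∂ν)

/-- A metric space has strong negative type if it has negative type and, for all Borel probability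
measures `μ, ν` with finite first moment, `∫ d(x, x') d(μ - ν)²(x, x') ≤ 0`, with equality only if
`μ = ν`. -/
def StrongNegativeType (X : Type*) [MetricSpace X] : Prop :=
  NegativeType X ∧
    ∀ [MeasurableSpace X] [BorelSpace X] (μ ν : Measure X)
      [IsProbabilityMeasure μ] [IsProbabilityMeasure ν],
      FiniteFirstMoment μ → FiniteFirstMoment ν →
        energyIntegral μ ν ≤ 0 ∧ (energyIntegral μ ν = 0 → μ = ν)

/-! ### Persistent homology of a filtration of simplicial complexes -/

section Homology

/-- The quotient `Z / (B ∩ Z)` for two subspaces `Z`, `B` of the same vector space. -/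
abbrev CyclesModBoundaries {𝕜 : Type*} [Field 𝕜] {C : Type*} [AddCommGroup C] [Module 𝕜 C]
    (Z B : Submodule 𝕜 C) : Type _ :=
  ↥Z ⧸ B.submoduleOf Z

variable (𝕜 : Type*) [Field 𝕜] {V : Type*} [LinearOrder V]

/-- The boundary of a single simplex, given by its set of vertices and oriented by the order of the
vertices. The facet opposite to the `i`-th smallest vertex (counted from zero) has sign `(-1) ^ i`.
The boundary of a vertex is zero (the homology is not reduced). -/
def simplexBoundary (s : Finset V) : Finset V →₀ 𝕜 :=
  ∑ v ∈ s, if (s.erase v).Nonempty then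
    Finsupp.single (s.erase v) ((-1) ^ (s.filter (fun w => w < v)).card) else 0

/-- The boundary map on simplicial chains with coefficients in `𝕜`. -/
def boundaryMap : (Finset V →₀ 𝕜) →ₗ[𝕜] (Finset V →₀ 𝕜) :=
  Finsupp.linearCombination 𝕜 (simplexBoundary 𝕜)

/-- The `n`-chains `C_n(L)`: linear combinations of the `n`-simplices of `L`. -/
def simplicialChains (L : PreAbstractSimplicialComplex V) (n : ℕ) : Submodule 𝕜 (Finset V →₀ 𝕜) :=
  Finsupp.supported 𝕜 𝕜 {s : Finset V | s ∈ L ∧ s.card = n + 1}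

/-- The `n`-cycles `Z_n(L)`. -/
def simplicialCycles (L : PreAbstractSimplicialComplex V) (n : ℕ) : Submodule 𝕜 (Finset V →₀ 𝕜) :=
  simplicialChains 𝕜 L n ⊓ LinearMap.ker (boundaryMap 𝕜)

/-- The `n`-boundaries `B_n(L)`. -/
def simplicialBoundaries (L : PreAbstractSimplicialComplex V) (n : ℕ) :
    Submodule 𝕜 (Finset V →₀ 𝕜) :=
  (simplicialChains 𝕜 L (n + 1)).map (boundaryMap 𝕜)

/-- The persistent homology `H_n(a, b) = Z_n(K_a) / (B_n(K_b) ∩ Z_n(K_a))` of a filtration `K`, that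
is, of a family of complexes with `K_a ⊆ K_b` for `a ≤ b`. -/
abbrev PersistentHomology (K : ℝ →o PreAbstractSimplicialComplex V) (n : ℕ) (a b : ℝ) : Type _ :=
  CyclesModBoundaries (simplicialCycles 𝕜 (K a) n) (simplicialBoundaries 𝕜 (K b) n)

/-- The persistent Betti number `β^{a,b} = dim H_n(a, b)`. -/
def persistentBetti (K : ℝ →o PreAbstractSimplicialComplex V) (n : ℕ) (a b : ℝ) : ℕ∞ :=
  Cardinal.toENat (Module.rank 𝕜 (PersistentHomology 𝕜 K n a b))

/-- The persistence landscape `λ_k(t) = sup {m ≥ 0 | β^{t-m,t+m} ≥ k}` of a filtration. The supremum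
is taken in `[0, ∞]`, so it is `0` if there is no such `m`. -/
def persistenceLandscape (K : ℝ →o PreAbstractSimplicialComplex V) (n : ℕ) (k : ℕ) (t : ℝ) :
    ℝ≥0∞ :=
  ⨆ (m : ℝ≥0) (_ : (k : ℕ∞) ≤ persistentBetti 𝕜 K n (t - m) (t + m)), (m : ℝ≥0∞)

end Homology

/-- A persistence diagram with finitely many off-diagonal points `(b, d)`, `b < d`, all of them with
finite coordinates. The point `(b, d)` stands for the bar `[b, d)`. -/
structure PersistenceDiagram where
  /-- the multiset of off-diagonal points -/
  points : Multiset (ℝ × ℝ)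
  birth_lt_death : ∀ x ∈ points, x.1 < x.2

/-- `D` is the persistence diagram of the degree `n` persistent homology of `K`: for `a ≤ b`, the
dimension of `H_n(a, b)` is the number of bars of `D` that contain both `a` and `b`. -/
def IsPersistenceDiagramOf (D : PersistenceDiagram) (𝕜 : Type*) [Field 𝕜] {V : Type*}
    [LinearOrder V] (K : ℝ →o PreAbstractSimplicialComplex V) (n : ℕ) : Prop :=
  ∀ a b : ℝ, a ≤ b →
    persistentBetti 𝕜 K n a b = (D.points.countP (fun x => x.1 ≤ a ∧ b < x.2) : ℕ∞)

/-! ### Spaces of persistence landscapes -/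

/-- The function space `L^p(ℕ × ℝ)` (counting measure times Lebesgue measure), with the norm
`‖f‖_p ^ p = ∑ k, ‖f_k‖_p ^ p` for `p < ∞` and `‖f‖_∞ = sup k, ‖f_k‖_∞`. The index `k = 0, 1, …`
corresponds to the landscape function `λ_{k+1}`. -/
abbrev LandscapeFunctionSpace (p : ℝ≥0∞) : Type :=
  Lp ℝ p ((Measure.count : Measure ℕ).prod (volume : Measure ℝ))

/-- `f` is (the class of) the persistence landscape of the degree `n` persistent homology of `K`. -/
def IsLandscapeOf {p : ℝ≥0∞} (f : LandscapeFunctionSpace p) (𝕜 : Type*) [Field 𝕜] {V : Type*}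
    [LinearOrder V] (K : ℝ →o PreAbstractSimplicialComplex V) (n : ℕ) : Prop :=
  ∀ᵐ x ∂((Measure.count : Measure ℕ).prod (volume : Measure ℝ)),
    ((f x : ℝ) : EReal) = (persistenceLandscape 𝕜 K n (x.1 + 1) x.2 : EReal)

/-- The persistence landscapes of filtrations that lie in `L^p`. -/
def landscapes (𝕜 : Type*) [Field 𝕜] (p : ℝ≥0∞) : Set (LandscapeFunctionSpace p) :=
  {f | ∃ (V : Type) (_ : LinearOrder V) (K : ℝ →o PreAbstractSimplicialComplex V) (n : ℕ),
    IsLandscapeOf f 𝕜 K n}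

/-- The persistence landscapes in `L^p` that arise from persistence diagrams: the landscapes of those
filtrations (of a complex on a finite vertex set) whose persistent homology is described by a
persistence diagram with finitely many off-diagonal points. -/
def diagramLandscapes (𝕜 : Type*) [Field 𝕜] (p : ℝ≥0∞) : Set (LandscapeFunctionSpace p) :=
  {f | ∃ (V : Type) (_ : LinearOrder V) (_ : Finite V)
    (K : ℝ →o PreAbstractSimplicialComplex V) (n : ℕ) (D : PersistenceDiagram),
    IsPersistenceDiagramOf D 𝕜 K n ∧ IsLandscapeOf f 𝕜 K n}

end

/-! The results on negative type rest on Schoenberg's theorem (`CondNegative.posSemidef_exp`): if a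
kernel `N` is conditionally negative, then `exp (-s * N)` is positive semidefinite for `s ≥ 0`. As
`r ^ α` is a mixture of the functions `1 - exp (-s * r)` for `0 < α < 1` (`rpow_eq_integral`), powers
of `N` with exponents in `(0, 1]` are conditionally negative too (`CondNegative.rpow`). Hence
`|a - b| ^ p = ((a - b) ^ 2) ^ (p / 2)` is conditionally negative for `p ≤ 2`, integration gives the
same for the `p`-th power of the `L^p` distance, and for `p ≥ 1` one may take the `p`-th root.

For strong negative type, the distance of a separable Hilbert space is written as a mixture of
`1 - exp (-s * ‖x - y‖ ^ 2)`. The energy of a pair of probability measures is then minus a mixture of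
their Gaussian energies, each of which is the squared distance of the mean embeddings of the two
measures in the reproducing kernel Hilbert space of the Gaussian kernel (`gaussianKernel_energy`). If
the energy vanishes, then so does the Gaussian energy for some `s > 0`, and the measures are equal
because the Gaussian kernel is characteristic (`eq_of_integral_gaussianKernel_eq`). Both kinds of
negative type pass to arbitrary subsets.

The counterexamples are landscapes of nested bars `[-h i, h i)` with `h 0 ≥ h 1 ≥ …`. The `k`-th
landscape function is the tent of height `h k` around `0`
(`IsHeightSequence.persistenceLandscape_filtration`), so that the heights act as independent
coordinates. Such bars occur in degree one for a filtration of a book of triangles with a common edge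
(`persistentBetti_bookFiltration`), where the boundary of a triangle appears at the birth of its bar
and the triangle at its death. In `L^1`, four landscapes in which two heights take two values each
form a rectangle, and the uniform measures on its two diagonals have energy zero. In `L^∞`, three
heights suffice to embed the complete bipartite graph on `2 + 3` vertices, which is not of negative
type. -/

/-! ### Conditionally negative kernels -/

/-- A real kernel is conditionally negative if all its quadratic forms with weights of total sum
zero are nonpositive. Weights are finitely supported, so that the index type may be infinite. -/
def CondNegative {ι : Type*} (N : ι → ι → ℝ) : Prop :=
  ∀ c : ι →₀ ℝ, (c.sum fun _ a => a) = 0 → (c.sum fun i a => c.sum fun j b => a * b * N i j) ≤ 0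

theorem condNegative_iff_fintype {ι : Type*} [Fintype ι] {N : ι → ι → ℝ} :
    CondNegative N ↔
      ∀ c : ι → ℝ, ∑ i, c i = 0 → ∑ i, ∑ j, c i * c j * N i j ≤ 0 := by
  constructor
  · intro h c hc
    have := h (Finsupp.equivFunOnFinite.symm c)
    simpa [Finsupp.sum_fintype, hc] using this
  · intro h c hc
    have := h c
    simp only [Finsupp.sum_fintype, zero_mul, mul_zero, implies_true, Finset.sum_const_zero]
      at this hc ⊢
    exact this hc

theorem negativeType_iff_condNegative {X : Type*} [MetricSpace X] :
    NegativeType X ↔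
      ∀ (n : ℕ) (x : Fin n → X), CondNegative fun i j => dist (x i) (x j) := by
  simp only [NegativeType, condNegative_iff_fintype]

/-- The squared distance of an inner product space is conditionally negative. -/
theorem condNegative_norm_sub_sq {ι E : Type*} [NormedAddCommGroup E] [InnerProductSpace ℝ E]
    (x : ι → E) : CondNegative fun i j => ‖x i - x j‖ ^ 2 := by
  intro c hc
  have key : (c.sum fun i a => c.sum fun j b => a * b * ‖x i - x j‖ ^ 2) =
      -2 * ‖c.sum fun i a => a • x i‖ ^ 2 := by
    rw [← real_inner_self_eq_norm_sq]
    simp only [Finsupp.sum] at hc ⊢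
    simp only [sum_inner, inner_sum, real_inner_smul_left, real_inner_smul_right,
      norm_sub_sq_real]
    have h1 : ∑ i ∈ c.support, ∑ j ∈ c.support, c i * c j * ‖x i‖ ^ 2 = 0 := by
      simp_rw [mul_right_comm _ (c _) (‖x _‖ ^ 2), ← Finset.mul_sum, hc]; simp
    have h2 : ∑ i ∈ c.support, ∑ j ∈ c.support, c i * c j * ‖x j‖ ^ 2 = 0 := by
      simp_rw [mul_assoc, ← Finset.mul_sum, ← Finset.sum_mul, hc]; simp
    have : ∀ i j, c i * c j * (‖x i‖ ^ 2 - 2 * inner ℝ (x i) (x j) + ‖x j‖ ^ 2) =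
        c i * c j * ‖x i‖ ^ 2 + c i * c j * ‖x j‖ ^ 2
          + -2 * (c j * (c i * inner ℝ (x j) (x i))) := by
      intro i j; rw [real_inner_comm (x i) (x j)]; ring
    simp_rw [this, Finset.sum_add_distrib, h1, h2, ← Finset.mul_sum]
    rw [zero_add, zero_add]
    simp only [Finset.mul_sum, mul_left_comm (c _) (c _)]
  rw [key]
  nlinarith [sq_nonneg ‖c.sum fun i a => a • x i‖]

/-- Entrywise limits of positive semidefinite matrices are positive semidefinite. -/
theorem Matrix.PosSemidef.of_tendsto {ι : Type*} {A : ℕ → Matrix ι ι ℝ} {B : Matrix ι ι ℝ}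
    (hA : ∀ n, (A n).PosSemidef)
    (h : ∀ i j, Filter.Tendsto (fun n => A n i j) Filter.atTop (nhds (B i j))) :
    B.PosSemidef := by
  refine ⟨?_, fun c => ?_⟩
  · ext i j
    refine tendsto_nhds_unique ((h j i).congr fun n => ?_) (h i j)
    simpa using (hA n).isHermitian.apply i j
  · refine ge_of_tendsto' (x := Filter.atTop)
      (f := fun n => c.sum fun i a => c.sum fun j b => star a * A n i j * b) ?_
      fun n => (hA n).2 c
    refine tendsto_finsetSum _ fun i _ => tendsto_finsetSum _ fun j _ => ?_
    exact ((h i j).const_mul _).mul_const _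

theorem posSemidef_one_entries (ι : Type*) : (Matrix.of fun _ _ : ι => (1 : ℝ)).PosSemidef := by
  refine ⟨by ext; simp, fun c => ?_⟩
  have : (c.sum fun i a => c.sum fun j b => star a * (Matrix.of fun _ _ : ι => (1 : ℝ)) i j * b)
      = (c.sum fun _ a => a) * (c.sum fun _ a => a) := by
    simp [Finsupp.sum, Finset.sum_mul_sum]
  rw [this]; exact mul_self_nonneg _

theorem Matrix.PosSemidef.map_pow {ι : Type*} {A : Matrix ι ι ℝ} (hA : A.PosSemidef) (n : ℕ) :
    (A.map (· ^ n)).PosSemidef := by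
  induction n with
  | zero => simpa [Matrix.map] using posSemidef_one_entries ι
  | succ n ih =>
    have h : A.map (· ^ (n + 1)) = (A.map (· ^ n)).hadamard A := by
      ext i j
      simp [pow_succ]
    rw [h]
    exact ih.hadamard hA

/-- The entrywise exponential is a limit of nonnegative combinations of entrywise powers, which are
positive semidefinite by the Schur product theorem. -/
theorem Matrix.PosSemidef.map_exp {ι : Type*} {A : Matrix ι ι ℝ} (hA : A.PosSemidef) :
    (A.map Real.exp).PosSemidef := by
  refine Matrix.PosSemidef.of_tendsto
    (A := fun n => ∑ k ∈ Finset.range n, ((k.factorial : ℝ)⁻¹) • A.map (· ^ k)) ?_ ?_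
  · intro n
    exact Matrix.posSemidef_sum _ fun k _ => (hA.map_pow k).smul (by positivity)
  · intro i j
    have := (NormedSpace.expSeries_div_hasSum_exp (A i j)).tendsto_sum_nat
    rw [← Real.exp_eq_exp_ℝ] at this
    refine this.congr fun n => ?_
    simp [Matrix.sum_apply, div_eq_inv_mul]

/-- Multiplication of the rows and columns by the same weights preserves semidefiniteness. -/
theorem Matrix.PosSemidef.mul_weights {ι : Type*} {A : Matrix ι ι ℝ} (hA : A.PosSemidef)
    (u : ι → ℝ) : (Matrix.of fun i j => u i * A i j * u j).PosSemidef := by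
  have h : (Matrix.of fun i j : ι => u i * u j).PosSemidef := by
    refine ⟨by ext; simp [mul_comm], fun c => ?_⟩
    have : (c.sum fun i a => c.sum fun j b =>
        star a * (Matrix.of fun i j : ι => u i * u j) i j * b)
        = (c.sum fun i a => a * u i) * (c.sum fun i a => a * u i) := by
      simp only [Finsupp.sum, Finset.sum_mul_sum, star_trivial, Matrix.of_apply]
      exact Finset.sum_congr rfl fun _ _ => Finset.sum_congr rfl fun _ _ => by ring
    rw [this]; exact mul_self_nonneg _
  have h' : (Matrix.of fun i j => u i * A i j * u j) =
      A.hadamard (Matrix.of fun i j : ι => u i * u j) := by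
    ext i j
    simp only [Matrix.of_apply, Matrix.hadamard_apply]; ring
  rw [h']
  exact hA.hadamard h

/-- Recentring a conditionally negative kernel at a base point gives a positive semidefinite one:
the weights are completed to total sum zero by a weight at the base point. -/
theorem CondNegative.posSemidef_recentre {ι : Type*} {N : ι → ι → ℝ} (hN : CondNegative N)
    (symm : ∀ i j, N i j = N j i) (o : ι) :
    (Matrix.of fun i j => N i o + N o j - N i j - N o o).PosSemidef := by
  classical
  refine ⟨by ext i j; simp [symm j o, symm i o, symm j i, add_comm], fun c => ?_⟩
  set S := c.sum fun _ a => a with hS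
  have hadd : ∀ (f : ι → ℝ), ((c - Finsupp.single o S).sum fun i a => a * f i)
      = (c.sum fun i a => a * f i) - S * f o := by
    intro f
    rw [Finsupp.sum_sub_index (by intros; ring)]
    simp
  have h := hN (c - Finsupp.single o S) (by
    have := hadd fun _ => 1
    simp only [mul_one] at this
    rw [this, hS, sub_self])
  have e1 : ∀ (c' : ι →₀ ℝ), (c'.sum fun i a => c'.sum fun j b => a * b * N i j)
      = c'.sum fun i a => a * (c'.sum fun j b => b * N i j) := by
    intro c'
    simp only [Finsupp.sum, Finset.mul_sum, mul_assoc]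
  rw [e1, hadd] at h
  simp only [hadd] at h
  have e2 : (c.sum fun i a => c.sum fun j b =>
      star a * (Matrix.of fun i j => N i o + N o j - N i j - N o o) i j * b)
      = (c.sum fun i a => a * N i o) * S + S * (c.sum fun j b => b * N o j)
        - (c.sum fun i a => a * (c.sum fun j b => b * N i j)) - S * S * N o o := by
    simp only [hS, Finsupp.sum, Finset.sum_mul_sum]
    simp only [star_trivial, Matrix.of_apply, Finset.mul_sum, Finset.sum_mul,
      ← Finset.sum_sub_distrib, ← Finset.sum_add_distrib]
    exact Finset.sum_congr rfl fun _ _ => Finset.sum_congr rfl fun _ _ => by ring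
  have e3 : (c.sum fun i a => a * ((c.sum fun j b => b * N i j) - S * N i o))
      = (c.sum fun i a => a * (c.sum fun j b => b * N i j)) - (c.sum fun i a => a * N i o) * S := by
    simp only [Finsupp.sum, Finset.sum_mul, ← Finset.sum_sub_distrib]
    exact Finset.sum_congr rfl fun _ _ => by ring
  rw [e3] at h
  rw [e2]
  linarith

/-- **Schoenberg's theorem**: the exponential of a conditionally negative kernel `N`, with negative
sign, is positive semidefinite. -/
theorem CondNegative.posSemidef_exp {ι : Type*} {N : ι → ι → ℝ} (hN : CondNegative N)
    (symm : ∀ i j, N i j = N j i) {s : ℝ} (hs : 0 ≤ s) :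
    (Matrix.of fun i j => Real.exp (-s * N i j)).PosSemidef := by
  rcases isEmpty_or_nonempty ι with _ | ⟨⟨o⟩⟩
  · convert Matrix.PosSemidef.zero (n := ι) (R := ℝ) using 1
    ext i; exact isEmptyElim i
  · -- The weights turn the recentred kernel back into `-s * N` in the exponent.
    have h := ((hN.posSemidef_recentre symm o).smul hs).map_exp.mul_weights
      fun i => Real.exp (-s * (N i o - N o o / 2))
    convert h using 1
    ext i j
    simp only [Matrix.of_apply, Matrix.map_apply, Matrix.smul_apply, smul_eq_mul, ← Real.exp_add]
    rw [symm o j]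
    congr 1; ring

/-! ### Fractional powers of conditionally negative kernels -/

/-- The integrand is at most `r * s ^ (-α)` near zero and `s ^ (-1 - α)` near infinity. -/
theorem integrableOn_one_sub_exp_mul_rpow {α r : ℝ} (hα : 0 < α) (hα1 : α < 1) (hr : 0 ≤ r) :
    IntegrableOn (fun s : ℝ => (1 - Real.exp (-s * r)) * s ^ (-1 - α)) (Set.Ioi 0) := by
  have hm : ∀ t : Set ℝ, AEStronglyMeasurable
      (fun s : ℝ => (1 - Real.exp (-s * r)) * s ^ (-1 - α)) (volume.restrict t) := fun t =>
    Measurable.aestronglyMeasurable (by fun_prop)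
  have h0 : ∀ s : ℝ, 0 < s → 0 ≤ 1 - Real.exp (-s * r) := fun s hs => by
    rw [sub_nonneg, Real.exp_le_one_iff]; nlinarith
  rw [← Set.Ioc_union_Ioi_eq_Ioi zero_le_one]
  refine IntegrableOn.union ?_ ?_
  · have : IntegrableOn (fun s : ℝ => r * s ^ (-α)) (Set.Ioc 0 1) := by
      have := (intervalIntegral.intervalIntegrable_rpow' (a := 0) (b := 1) (r := -α) (by linarith))
      rw [intervalIntegrable_iff_integrableOn_Ioc_of_le zero_le_one] at this
      exact this.const_mul r
    refine this.mono' (hm _) ?_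
    filter_upwards [ae_restrict_mem measurableSet_Ioc] with s hs
    have hs0 : 0 < s := hs.1
    rw [Real.norm_of_nonneg (mul_nonneg (h0 s hs0) (by positivity))]
    have e : r * s ^ (-α) = (s * r) * s ^ (-1 - α) := by
      rw [show -α = 1 + (-1 - α) by ring, Real.rpow_add hs0, Real.rpow_one]; ring
    rw [e]
    gcongr
    have := Real.add_one_le_exp (-s * r)
    linarith
  · have : IntegrableOn (fun s : ℝ => s ^ (-1 - α)) (Set.Ioi 1) :=
      integrableOn_Ioi_rpow_of_lt (by linarith) one_pos
    refine this.mono' (hm _) ?_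
    filter_upwards [ae_restrict_mem measurableSet_Ioi] with s hs
    have hs0 : 0 < s := one_pos.trans hs
    rw [Real.norm_of_nonneg (mul_nonneg (h0 s hs0) (by positivity))]
    have := Real.exp_pos (-s * r)
    exact mul_le_of_le_one_left (by positivity) (by linarith)

theorem integral_one_sub_exp_mul_rpow_pos {α : ℝ} (hα : 0 < α) (hα1 : α < 1) :
    0 < ∫ s in Set.Ioi (0 : ℝ), (1 - Real.exp (-s)) * s ^ (-1 - α) := by
  have hpos : ∀ s ∈ Set.Ioi (0 : ℝ), 0 < (1 - Real.exp (-s)) * s ^ (-1 - α) := fun s hs => by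
    have hs : 0 < s := hs
    have : Real.exp (-s) < 1 := by simpa using hs
    exact mul_pos (by linarith) (by positivity)
  have hi := integrableOn_one_sub_exp_mul_rpow hα hα1 zero_le_one
  simp only [mul_one] at hi
  rw [setIntegral_pos_iff_support_of_nonneg_ae _ hi]
  · rw [Set.inter_eq_right.mpr fun s hs => Function.mem_support.mpr (hpos s hs).ne']; simp
  · filter_upwards [ae_restrict_mem measurableSet_Ioi] with s hs using (hpos s hs).le

/-- A power `r ^ α` with `0 < α < 1` is, up to a positive constant, a mixture of the functions
`1 - exp (-s * r)`. The value of the constant is immaterial. -/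
theorem rpow_eq_integral {α r : ℝ} (hα : 0 < α) (hr : 0 ≤ r) :
    r ^ α * ∫ s in Set.Ioi (0 : ℝ), (1 - Real.exp (-s)) * s ^ (-1 - α) =
      ∫ s in Set.Ioi (0 : ℝ), (1 - Real.exp (-s * r)) * s ^ (-1 - α) := by
  rcases hr.eq_or_lt with rfl | hr
  · simp [Real.zero_rpow hα.ne']
  have h := integral_comp_mul_left_Ioi (fun s : ℝ => (1 - Real.exp (-s)) * s ^ (-1 - α)) 0 hr
  rw [mul_zero, smul_eq_mul] at h
  have h2 : ∫ s in Set.Ioi (0 : ℝ), (1 - Real.exp (-(r * s))) * (r * s) ^ (-1 - α) =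
      r ^ (-1 - α) * ∫ s in Set.Ioi (0 : ℝ), (1 - Real.exp (-s * r)) * s ^ (-1 - α) := by
    rw [← integral_const_mul]
    refine setIntegral_congr_fun measurableSet_Ioi fun s hs => ?_
    have hs : 0 < s := hs
    rw [Real.mul_rpow hr.le hs.le, show -(r * s) = -s * r by ring]; ring
  rw [h2, Real.rpow_sub hr, Real.rpow_neg hr.le, Real.rpow_one] at h
  have : 0 < r ^ α := by positivity
  set I := ∫ s in Set.Ioi (0 : ℝ), (1 - Real.exp (-s * r)) * s ^ (-1 - α)
  field_simp at h
  exact h.symm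

/-- Fractional powers of nonnegative conditionally negative kernels are conditionally negative. -/
theorem CondNegative.rpow {ι : Type*} {N : ι → ι → ℝ} (hN : CondNegative N)
    (symm : ∀ i j, N i j = N j i) (nonneg : ∀ i j, 0 ≤ N i j) {α : ℝ} (hα : 0 < α) (hα1 : α ≤ 1) :
    CondNegative fun i j => N i j ^ α := by
  rcases hα1.eq_or_lt with rfl | hα1
  · simpa using hN
  intro c hc
  have hC := integral_one_sub_exp_mul_rpow_pos hα hα1
  set C := ∫ s in Set.Ioi (0 : ℝ), (1 - Real.exp (-s)) * s ^ (-1 - α)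
  refine nonpos_of_mul_nonpos_left ?_ hC
  have hint : ∀ i j, IntegrableOn (fun s : ℝ => c i * c j *
      ((1 - Real.exp (-s * N i j)) * s ^ (-1 - α))) (Set.Ioi 0) := fun i j =>
    (integrableOn_one_sub_exp_mul_rpow hα hα1 (nonneg i j)).const_mul _
  have key : (c.sum fun i a => c.sum fun j b => a * b * N i j ^ α) * C =
      ∫ s in Set.Ioi (0 : ℝ), ∑ i ∈ c.support, ∑ j ∈ c.support,
        c i * c j * ((1 - Real.exp (-s * N i j)) * s ^ (-1 - α)) := by
    rw [integral_finsetSum _ fun i _ => integrable_finsetSum _ fun j _ => hint i j]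
    simp only [Finsupp.sum, Finset.sum_mul]
    refine Finset.sum_congr rfl fun i _ => ?_
    rw [integral_finsetSum _ fun j _ => hint i j]
    refine Finset.sum_congr rfl fun j _ => ?_
    rw [integral_const_mul, ← rpow_eq_integral hα (nonneg i j), mul_assoc]
  rw [key]
  refine setIntegral_nonpos measurableSet_Ioi fun s hs => ?_
  have hs : 0 < s := hs
  have hpsd := (hN.posSemidef_exp symm hs.le).2 c
  have : ∑ i ∈ c.support, ∑ j ∈ c.support,
      c i * c j * ((1 - Real.exp (-s * N i j)) * s ^ (-1 - α)) =
      ((∑ i ∈ c.support, c i) * (∑ j ∈ c.support, c j) -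
        c.sum fun i a => c.sum fun j b =>
          star a * (Matrix.of fun i j => Real.exp (-s * N i j)) i j * b) * s ^ (-1 - α) := by
    simp only [Finsupp.sum, Finset.sum_mul_sum]
    simp only [← Finset.sum_sub_distrib, Finset.sum_mul, Matrix.of_apply, star_trivial]
    exact Finset.sum_congr rfl fun _ _ => Finset.sum_congr rfl fun _ _ => by ring
  rw [this]
  have hc' : ∑ i ∈ c.support, c i = 0 := hc
  rw [hc']
  refine mul_nonpos_of_nonpos_of_nonneg ?_ (by positivity)
  linarith

/-! ### `L^p` spaces with `1 ≤ p ≤ 2` are of negative type -/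

theorem NegativeType.subset {X : Type*} [MetricSpace X] (h : NegativeType X) (S : Set X) :
    NegativeType S := fun n x α hα => h n (fun i => (x i : X)) α hα

theorem condNegative_abs_sub_rpow {ι : Type*} (x : ι → ℝ) {q : ℝ} (hq : 0 < q) (hq2 : q ≤ 2) :
    CondNegative fun i j => |x i - x j| ^ q := by
  have h := (condNegative_norm_sub_sq x).rpow (α := q / 2)
    (fun i j => by rw [norm_sub_rev]) (fun i j => by positivity) (by positivity) (by linarith)
  convert h using 3 with i j
  rw [← Real.rpow_natCast, ← Real.rpow_mul (norm_nonneg _), Real.norm_eq_abs]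
  congr 1
  push_cast; ring

theorem Lp_dist_eq_integral {Ω : Type*} {mΩ : MeasurableSpace Ω} {μ : Measure Ω} {p : ℝ≥0∞}
    (hp : p ≠ 0) (hp' : p ≠ ∞) (f g : Lp ℝ p μ) :
    dist f g = (∫ ω, |f ω - g ω| ^ p.toReal ∂μ) ^ p.toReal⁻¹ := by
  rw [Lp.dist_def, ((Lp.memLp f).sub (Lp.memLp g)).eLpNorm_eq_integral_rpow_norm hp hp',
    ENNReal.toReal_ofReal (by positivity)]
  simp

/-- The `p`-th power of the `L^p` distance is conditionally negative because it is so pointwise, and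
Schoenberg's theorem then allows to take the `p`-th root. -/
theorem negativeType_Lp {Ω : Type*} {mΩ : MeasurableSpace Ω} {μ : Measure Ω} {p : ℝ≥0∞}
    [hp1 : Fact (1 ≤ p)] (hp2 : p ≤ 2) : NegativeType (Lp ℝ p μ) := by
  rw [negativeType_iff_condNegative]
  intro n x
  have hp0 : p ≠ 0 := (one_pos.trans_le hp1.out).ne'
  have hpt : p ≠ ∞ := (hp2.trans_lt (by simp)).ne
  have hq1 : 1 ≤ p.toReal := by
    simpa using ENNReal.toReal_mono hpt hp1.out
  have hq2 : p.toReal ≤ 2 := by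
    simpa using ENNReal.toReal_mono (by simp) hp2
  simp_rw [Lp_dist_eq_integral hp0 hpt]
  refine CondNegative.rpow ?_ (fun i j => by simp_rw [abs_sub_comm]) (fun i j => by positivity)
    (by positivity) (inv_le_one_of_one_le₀ hq1)
  rw [condNegative_iff_fintype]
  intro c hc
  have hint : ∀ i j, Integrable (fun ω => c i * c j * |x i ω - x j ω| ^ p.toReal) μ := fun i j => by
    have := ((Lp.memLp (x i)).sub (Lp.memLp (x j))).integrable_norm_rpow hp0 hpt
    simpa using this.const_mul (c i * c j)
  simp_rw [← integral_const_mul]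
  simp_rw [← integral_finsetSum _ fun j _ => hint _ j]
  rw [← integral_finsetSum _ fun i _ => integrable_finsetSum _ fun j _ => hint i j]
  refine integral_nonpos fun ω => ?_
  exact condNegative_iff_fintype.mp
    (condNegative_abs_sub_rpow (fun i => x i ω) (by positivity) hq2) c hc

/-! ### Mean embeddings for the Gaussian kernel -/

/-- A positive semidefinite kernel is the kernel of inner products of a family of vectors, namely of
the kernel functions in its reproducing kernel Hilbert space. -/
theorem Matrix.PosSemidef.exists_featureMap.{u} {X : Type u} {k : Matrix X X ℝ} (hk : k.PosSemidef) :
    ∃ (H : Type u) (_ : NormedAddCommGroup H) (_ : InnerProductSpace ℝ H) (_ : CompleteSpace H)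
      (φ : X → H), ∀ x y, inner ℝ (φ x) (φ y) = k x y := by
  set K : Matrix X X (ℝ →L[ℝ] ℝ) := Matrix.of fun x y => k x y • ContinuousLinearMap.id ℝ ℝ with hK
  have hKpsd : K.PosSemidef := by
    have h := (RKHS.posSemidef_tfae (K := K)).out 0 2
    refine h.mpr ⟨?_, fun c => ?_⟩
    · ext x y
      have := hk.isHermitian.apply x y
      simp only [star_trivial] at this
      rw [Matrix.conjTranspose_apply, hK]
      simp only [Matrix.of_apply, star_smul, star_trivial, this]
      rw [ContinuousLinearMap.star_eq_adjoint, ContinuousLinearMap.adjoint_id]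
    · have := hk.2 c
      simp only [Finsupp.sum, star_trivial] at this ⊢
      rw [RCLike.re_to_real]
      refine this.trans_eq ?_
      rw [Finset.sum_comm]
      refine Finset.sum_congr rfl fun x _ => Finset.sum_congr rfl fun y _ => ?_
      simp [hK]; ring
  have : Fact K.PosSemidef := ⟨hKpsd⟩
  refine ⟨RKHS.OfKernel K, inferInstance, inferInstance, inferInstance,
    fun x => RKHS.kerFun (RKHS.OfKernel K) x 1, fun x y => ?_⟩
  rw [← RKHS.kernel_inner, RKHS.OfKernel.kernel_ofKernel]
  have := hk.isHermitian.apply x y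
  simp only [star_trivial] at this
  simp [hK, this]

section MeanEmbedding

variable {E : Type*} [NormedAddCommGroup E] [MeasurableSpace E] [BorelSpace E]

theorem integrable_exp_neg_norm_sq {Ω : Type*} [MeasurableSpace Ω] (ρ : Measure Ω)
    [IsFiniteMeasure ρ] {s : ℝ} (hs : 0 ≤ s) {f : Ω → E} (hf : Measurable f) :
    Integrable (fun ω => Real.exp (-s * ‖f ω‖ ^ 2)) ρ := by
  refine Integrable.of_bound (C := 1)
    ((hf.norm.pow_const 2).const_mul (-s)).exp.aestronglyMeasurable ?_
  filter_upwards with ω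
  rw [Real.norm_of_nonneg (Real.exp_pos _).le, Real.exp_le_one_iff]
  nlinarith [mul_nonneg hs (sq_nonneg ‖f ω‖)]

variable [InnerProductSpace ℝ E] [SecondCountableTopology E] (μ ν : Measure E)
  [IsProbabilityMeasure μ] [IsProbabilityMeasure ν]

/-- The Gaussian kernel integrated against the square of `μ - ν` is the squared distance of the mean
embeddings of `μ` and `ν`. If it vanishes, then the mean embeddings are equal, which gives the
equality of the integrals of all functions `exp (-s * ‖· - y‖ ^ 2)`. -/
theorem gaussianKernel_energy {s : ℝ} (hs : 0 ≤ s) :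
    let Q := fun ρ : Measure (E × E) => ∫ z, Real.exp (-s * ‖z.1 - z.2‖ ^ 2) ∂ρ
    0 ≤ Q (μ.prod μ) - Q (μ.prod ν) - Q (ν.prod μ) + Q (ν.prod ν) ∧
      (Q (μ.prod μ) - Q (μ.prod ν) - Q (ν.prod μ) + Q (ν.prod ν) = 0 →
        ∀ y, ∫ x, Real.exp (-s * ‖x - y‖ ^ 2) ∂μ = ∫ x, Real.exp (-s * ‖x - y‖ ^ 2) ∂ν) := by
  intro Q
  obtain ⟨H, _, _, _, φ, hφ⟩ := ((condNegative_norm_sub_sq (fun x : E => x)).posSemidef_exp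
    (fun x y => by rw [norm_sub_rev]) hs).exists_featureMap
  simp only [Matrix.of_apply] at hφ
  have hnorm : ∀ x, ‖φ x‖ = 1 := fun x => by
    have := hφ x x
    rw [real_inner_self_eq_norm_sq] at this
    exact (sq_eq_sq₀ (norm_nonneg _) zero_le_one).mp (by simpa using this)
  have hcont : Continuous φ := by
    rw [continuous_iff_continuousAt]
    intro x
    rw [ContinuousAt, tendsto_iff_norm_sub_tendsto_zero]
    have h : ∀ y, ‖φ y - φ x‖ = √(2 - 2 * Real.exp (-s * ‖y - x‖ ^ 2)) := fun y => by
      rw [← Real.sqrt_sq (norm_nonneg (φ y - φ x)), norm_sub_sq_real, hφ, hnorm, hnorm]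
      congr 1; ring
    simp_rw [h]
    have : Continuous fun y => √(2 - 2 * Real.exp (-s * ‖y - x‖ ^ 2)) := by fun_prop
    simpa using this.tendsto x
  have hint : ∀ (ρ : Measure E) [IsProbabilityMeasure ρ], Integrable φ ρ := fun ρ _ =>
    Integrable.of_bound hcont.stronglyMeasurable.aestronglyMeasurable 1
      (by filter_upwards with x using (hnorm x).le)
  have hpair : ∀ (ρ : Measure E) [IsProbabilityMeasure ρ] (y : E),
      ∫ x, Real.exp (-s * ‖x - y‖ ^ 2) ∂ρ = inner ℝ (φ y) (∫ x, φ x ∂ρ) := fun ρ _ y => by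
    rw [← integral_inner (hint ρ)]
    simp_rw [hφ, norm_sub_rev]
  have hQ : ∀ (ρ τ : Measure E) [IsProbabilityMeasure ρ] [IsProbabilityMeasure τ],
      Q (ρ.prod τ) = inner ℝ (∫ x, φ x ∂ρ) (∫ x, φ x ∂τ) := fun ρ τ _ _ => by
    have e1 : Q (ρ.prod τ) = ∫ x, ∫ y, Real.exp (-s * ‖x - y‖ ^ 2) ∂τ ∂ρ :=
      integral_prod _ (integrable_exp_neg_norm_sq _ hs (by fun_prop))
    rw [e1]
    have e2 : ∀ x, ∫ y, Real.exp (-s * ‖x - y‖ ^ 2) ∂τ = inner ℝ (∫ y, φ y ∂τ) (φ x) := fun x => by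
      simp_rw [norm_sub_rev x]
      rw [hpair, real_inner_comm]
    simp_rw [e2]
    rw [integral_inner (hint ρ), real_inner_comm]
  have key : Q (μ.prod μ) - Q (μ.prod ν) - Q (ν.prod μ) + Q (ν.prod ν) =
      ‖∫ x, φ x ∂μ - ∫ x, φ x ∂ν‖ ^ 2 := by
    rw [hQ, hQ, hQ, hQ, ← real_inner_self_eq_norm_sq, inner_sub_left, inner_sub_right,
      inner_sub_right]
    ring
  rw [key]
  refine ⟨by positivity, fun h y => ?_⟩
  have : ∫ x, φ x ∂μ = ∫ x, φ x ∂ν := by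
    rw [← sub_eq_zero, ← norm_eq_zero]
    exact pow_eq_zero_iff two_ne_zero |>.mp h
  rw [hpair, hpair, this]

/-- The Gaussian kernel is characteristic: weighting both measures by `exp (-s * ‖x‖ ^ 2)` turns the
hypothesis into the equality of their Laplace transforms, and measures with equal everywhere finite
Laplace transforms have equal characteristic functions by analytic continuation. -/
theorem eq_of_integral_gaussianKernel_eq [CompleteSpace E] {s : ℝ} (hs : 0 < s)
    (h : ∀ y, ∫ x, Real.exp (-s * ‖x - y‖ ^ 2) ∂μ = ∫ x, Real.exp (-s * ‖x - y‖ ^ 2) ∂ν) :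
    μ = ν := by
  set w : E → ℝ≥0∞ := fun x => ENNReal.ofReal (Real.exp (-s * ‖x‖ ^ 2)) with hw
  have hwm : Measurable w := by fun_prop
  have hw0 : ∀ x, w x ≠ 0 := fun x => by simp [hw, Real.exp_pos]
  have hwt : ∀ x, w x ≠ ∞ := fun x => by simp [hw]
  have hfin : ∀ (ρ : Measure E) [IsProbabilityMeasure ρ], IsFiniteMeasure (ρ.withDensity w) :=
    fun ρ _ => isFiniteMeasure_withDensity_ofReal
      (integrable_exp_neg_norm_sq ρ hs.le measurable_id).2
  have := hfin μ
  have := hfin ν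
  -- Completing the square.
  have hsq : ∀ x y : E, Real.exp (-s * ‖x‖ ^ 2) * Real.exp (inner ℝ x y) =
      Real.exp (‖y‖ ^ 2 / (4 * s)) * Real.exp (-s * ‖x - (1 / (2 * s)) • y‖ ^ 2) := fun x y => by
    rw [← Real.exp_add, ← Real.exp_add, norm_sub_sq_real, real_inner_smul_right, norm_smul,
      mul_pow, Real.norm_eq_abs, sq_abs]
    congr 1
    field_simp
    ring
  have hmgf : ∀ (ρ : Measure E) [IsProbabilityMeasure ρ] (y : E),
      ∫ x, Real.exp (inner ℝ x y) ∂(ρ.withDensity w) = Real.exp (‖y‖ ^ 2 / (4 * s)) *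
        ∫ x, Real.exp (-s * ‖x - (1 / (2 * s)) • y‖ ^ 2) ∂ρ := fun ρ _ y => by
    rw [integral_withDensity_eq_integral_toReal_smul hwm
      (Filter.Eventually.of_forall fun x => (hwt x).lt_top), ← integral_const_mul]
    refine integral_congr_ae (Filter.Eventually.of_forall fun x => ?_)
    simp only [hw, smul_eq_mul]
    rw [ENNReal.toReal_ofReal (Real.exp_pos _).le, hsq]
  have hexp : ∀ (ρ : Measure E) [IsProbabilityMeasure ρ] (y : E),
      Integrable (fun x => Real.exp (inner ℝ x y)) (ρ.withDensity w) := fun ρ _ y => by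
    rw [integrable_withDensity_iff_integrable_smul' hwm
      (Filter.Eventually.of_forall fun x => (hwt x).lt_top)]
    refine ((integrable_exp_neg_norm_sq (E := E) ρ hs.le
      (f := fun x => x - (1 / (2 * s)) • y) (by fun_prop)).const_mul
        (Real.exp (‖y‖ ^ 2 / (4 * s)))).congr (Filter.Eventually.of_forall fun x => ?_)
    simp only [hw, smul_eq_mul]
    rw [ENNReal.toReal_ofReal (Real.exp_pos _).le, hsq]
  have hzero : μ.withDensity w = 0 ↔ ν.withDensity w = 0 := by
    have hne : ∀ (ρ : Measure E) [IsProbabilityMeasure ρ], ρ.withDensity w ≠ 0 := fun ρ _ h0 => by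
      rw [withDensity_eq_zero_iff hwm.aemeasurable] at h0
      obtain ⟨x, hx⟩ := h0.exists
      exact hw0 x hx
    simp [hne μ, hne ν]
  have heq : μ.withDensity w = ν.withDensity w := by
    refine Measure.ext_of_charFun (funext fun y => ?_)
    have h1 : ProbabilityTheory.mgf (fun x => inner ℝ x y) (μ.withDensity w) =
        ProbabilityTheory.mgf (fun x => inner ℝ x y) (ν.withDensity w) := by
      funext t
      simp only [ProbabilityTheory.mgf, ← real_inner_smul_right]
      rw [hmgf, hmgf, h]
    have h2 : ProbabilityTheory.integrableExpSet (fun x => inner ℝ x y) (μ.withDensity w) =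
        Set.univ := by
      refine Set.eq_univ_of_forall fun t => ?_
      simp only [ProbabilityTheory.integrableExpSet, Set.mem_ofPred_eq, ← real_inner_smul_right]
      exact hexp μ _
    have h3 := ProbabilityTheory.eqOn_complexMGF_of_mgf' h1 hzero
      (x := Complex.I) (by simp [h2])
    simp only [ProbabilityTheory.complexMGF] at h3
    simp only [charFun_apply]
    simpa only [mul_comm Complex.I] using h3
  have hinv : ∀ ρ : Measure E, (ρ.withDensity w).withDensity (fun x => (w x)⁻¹) = ρ := fun ρ =>
    withDensity_inv_same hwm (Filter.Eventually.of_forall hw0) (Filter.Eventually.of_forall hwt)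
  rw [← hinv μ, heq, hinv ν]

end MeanEmbedding

/-! ### Separable Hilbert spaces are of strong negative type -/

/-- The representation of `r ^ α` as a mixture of the functions `1 - exp (-s * r)`, integrated by
Fubini's theorem. -/
theorem integral_rpow_eq_integral {Ω : Type*} [MeasurableSpace Ω] {ρ : Measure Ω}
    [IsFiniteMeasure ρ] {r : Ω → ℝ} (hr : Measurable r) (hr0 : ∀ ω, 0 ≤ r ω) {α : ℝ} (hα : 0 < α)
    (hα1 : α < 1) (hint : Integrable (fun ω => r ω ^ α) ρ) :
    IntegrableOn (fun s : ℝ => (∫ ω, 1 - Real.exp (-s * r ω) ∂ρ) * s ^ (-1 - α)) (Set.Ioi 0) ∧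
    (∫ ω, r ω ^ α ∂ρ) * (∫ s in Set.Ioi (0 : ℝ), (1 - Real.exp (-s)) * s ^ (-1 - α)) =
      ∫ s in Set.Ioi (0 : ℝ), (∫ ω, 1 - Real.exp (-s * r ω) ∂ρ) * s ^ (-1 - α) := by
  have hI : Integrable (Function.uncurry fun ω (s : ℝ) =>
      (1 - Real.exp (-s * r ω)) * s ^ (-1 - α)) (ρ.prod (volume.restrict (Set.Ioi 0))) := by
    rw [integrable_prod_iff (Measurable.aestronglyMeasurable (by unfold Function.uncurry; fun_prop))]
    refine ⟨Filter.Eventually.of_forall fun ω =>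
      integrableOn_one_sub_exp_mul_rpow hα hα1 (hr0 ω), ?_⟩
    refine (hint.mul_const (∫ s in Set.Ioi (0 : ℝ), (1 - Real.exp (-s)) * s ^ (-1 - α))).congr
      (Filter.Eventually.of_forall fun ω => ?_)
    simp only [rpow_eq_integral hα (hr0 ω)]
    refine setIntegral_congr_fun measurableSet_Ioi fun s hs => ?_
    have hs : 0 < s := hs
    have : Real.exp (-s * r ω) ≤ 1 := by
      rw [Real.exp_le_one_iff]; nlinarith [mul_nonneg hs.le (hr0 ω)]
    exact (Real.norm_of_nonneg (mul_nonneg (by linarith) (by positivity))).symm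
  constructor
  · have := hI.integral_prod_right
    simp only [Function.uncurry, integral_mul_const] at this
    exact this
  · rw [← integral_mul_const]
    simp_rw [rpow_eq_integral hα (hr0 _)]
    rw [integral_integral_swap hI]
    simp_rw [integral_mul_const]

theorem FiniteFirstMoment.integrable_dist {X : Type*} [MetricSpace X] [MeasurableSpace X]
    [BorelSpace X] [SecondCountableTopology X] {μ ν : Measure X} [IsProbabilityMeasure μ]
    [IsProbabilityMeasure ν] (hμ : FiniteFirstMoment μ) (hν : FiniteFirstMoment ν) :
    Integrable (fun z : X × X => dist z.1 z.2) (μ.prod ν) := by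
  obtain ⟨o⟩ : Nonempty X := nonempty_of_isProbabilityMeasure μ
  refine (((hμ o).comp_fst ν).add ((hν o).comp_snd μ)).mono'
    (by fun_prop) (Filter.Eventually.of_forall fun z => ?_)
  rw [Real.norm_of_nonneg dist_nonneg]
  exact dist_triangle_left _ _ _

/-- The energy is, up to a positive constant, minus the integral over `s > 0` of the Gaussian energies
with parameter `s` and weight `s ^ (-3 / 2)`. The constant `1` in `1 - exp (-s * ‖x - y‖ ^ 2)` drops
out because `μ - ν` has total mass zero. -/
theorem strongNegativeType_of_innerProductSpace {E : Type*} [NormedAddCommGroup E]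
    [InnerProductSpace ℝ E] [CompleteSpace E] [SecondCountableTopology E] :
    StrongNegativeType E := by
  constructor
  · rw [negativeType_iff_condNegative]
    intro n x
    have h := (condNegative_norm_sub_sq x).rpow (α := 1 / 2)
      (fun i j => by rw [norm_sub_rev]) (fun i j => by positivity) (by norm_num) (by norm_num)
    convert h using 3 with i j
    rw [← Real.sqrt_eq_rpow, Real.sqrt_sq (norm_nonneg _), dist_eq_norm]
  intro _ _ μ ν _ _ hμ hν
  have hα : (0 : ℝ) < 1 / 2 := by norm_num
  have hα1 : (1 / 2 : ℝ) < 1 := by norm_num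
  have hC := integral_one_sub_exp_mul_rpow_pos hα hα1
  set C := ∫ s in Set.Ioi (0 : ℝ), (1 - Real.exp (-s)) * s ^ (-1 - (1 / 2) : ℝ)
  have hsqrt : ∀ z : E × E, (‖z.1 - z.2‖ ^ 2) ^ (1 / 2 : ℝ) = dist z.1 z.2 := fun z => by
    rw [← Real.sqrt_eq_rpow, Real.sqrt_sq (norm_nonneg _), dist_eq_norm]
  -- Keeping `F` abstract lets the sums and differences of integrals be matched syntactically.
  obtain ⟨F, hF⟩ : ∃ F : Measure E → Measure E → ℝ → ℝ, ∀ ρ τ s, F ρ τ s =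
      (1 - ∫ z, Real.exp (-s * ‖z.1 - z.2‖ ^ 2) ∂(ρ.prod τ)) * s ^ (-1 - (1 / 2) : ℝ) :=
    ⟨_, fun _ _ _ => rfl⟩
  have hrep : ∀ (ρ τ : Measure E) [IsProbabilityMeasure ρ] [IsProbabilityMeasure τ],
      FiniteFirstMoment ρ → FiniteFirstMoment τ →
      Integrable (F ρ τ) (volume.restrict (Set.Ioi 0)) ∧
      (∫ x, ∫ y, dist x y ∂τ ∂ρ) * C = ∫ s in Set.Ioi (0 : ℝ), F ρ τ s := by
    intro ρ τ _ _ hρ hτ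
    have hd := hρ.integrable_dist hτ
    obtain ⟨h1, h2⟩ := integral_rpow_eq_integral (ρ := ρ.prod τ)
      (r := fun z : E × E => ‖z.1 - z.2‖ ^ 2) (by fun_prop) (fun z => by positivity) hα hα1
      (by simpa only [hsqrt] using hd)
    have hG : Set.EqOn (fun s : ℝ => (∫ z, 1 - Real.exp (-s * ‖z.1 - z.2‖ ^ 2) ∂(ρ.prod τ)) *
        s ^ (-1 - (1 / 2) : ℝ)) (F ρ τ) (Set.Ioi 0) := fun s hs => by
      simp only [hF]
      rw [integral_sub (integrable_const _) (integrable_exp_neg_norm_sq _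
        (le_of_lt (Set.mem_Ioi.mp hs)) (f := fun z : E × E => z.1 - z.2) (by fun_prop))]
      simp
    refine ⟨h1.congr_fun hG measurableSet_Ioi, ?_⟩
    rw [← setIntegral_congr_fun measurableSet_Ioi hG, ← h2]
    simp_rw [hsqrt]
    rw [integral_prod _ hd]
  set Q : ℝ → ℝ := fun s =>
    (∫ z, Real.exp (-s * ‖z.1 - z.2‖ ^ 2) ∂(μ.prod μ)) -
    (∫ z, Real.exp (-s * ‖z.1 - z.2‖ ^ 2) ∂(μ.prod ν)) -
    (∫ z, Real.exp (-s * ‖z.1 - z.2‖ ^ 2) ∂(ν.prod μ)) +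
    (∫ z, Real.exp (-s * ‖z.1 - z.2‖ ^ 2) ∂(ν.prod ν)) with hQ
  have hQ0 : ∀ s ∈ Set.Ioi (0 : ℝ), 0 ≤ Q s := fun s hs =>
    (gaussianKernel_energy μ ν (le_of_lt (Set.mem_Ioi.mp hs))).1
  obtain ⟨i1, e1⟩ := hrep μ μ hμ hμ
  obtain ⟨i2, e2⟩ := hrep μ ν hμ hν
  obtain ⟨i3, e3⟩ := hrep ν μ hν hμ
  obtain ⟨i4, e4⟩ := hrep ν ν hν hν
  have hsum : F μ μ - F μ ν - F ν μ + F ν ν = fun s => -(Q s * s ^ (-1 - (1 / 2) : ℝ)) := by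
    funext s
    simp only [hQ, Pi.add_apply, Pi.sub_apply, hF]; ring
  have hi := ((i1.sub i2).sub i3).add i4
  have hQi : IntegrableOn (fun s : ℝ => Q s * s ^ (-1 - (1 / 2) : ℝ)) (Set.Ioi 0) := by
    rw [hsum] at hi
    simpa [IntegrableOn] using hi.neg
  have key : energyIntegral μ ν * C = -∫ s in Set.Ioi (0 : ℝ), Q s * s ^ (-1 - (1 / 2) : ℝ) := by
    rw [energyIntegral, add_mul, sub_mul, sub_mul, e1, e2, e3, e4, ← integral_sub' i1 i2,
      ← integral_sub' (i1.sub i2) i3, ← integral_add' ((i1.sub i2).sub i3) i4, hsum, integral_neg]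
  have hnn : ∀ s ∈ Set.Ioi (0 : ℝ), 0 ≤ Q s * s ^ (-1 - (1 / 2) : ℝ) := fun s hs =>
    mul_nonneg (hQ0 s hs) (Real.rpow_nonneg (le_of_lt hs) _)
  refine ⟨nonpos_of_mul_nonpos_left ?_ hC, fun h0 => ?_⟩
  · rw [key, neg_nonpos]
    exact setIntegral_nonneg measurableSet_Ioi hnn
  · rw [h0, zero_mul, zero_eq_neg, setIntegral_eq_zero_iff_of_nonneg_ae
      ((ae_restrict_mem measurableSet_Ioi).mono hnn) hQi] at key
    -- One positive `s` with vanishing Gaussian energy suffices.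
    obtain ⟨s, hs, hs0⟩ : ∃ s : ℝ, s ∈ Set.Ioi (0 : ℝ) ∧ Q s * s ^ (-1 - (1 / 2) : ℝ) = 0 := by
      have : (ae (volume.restrict (Set.Ioi (0 : ℝ)))).NeBot := by
        rw [ae_neBot]; intro h; simpa using congrArg (fun m => m Set.univ) h
      exact ((ae_restrict_mem measurableSet_Ioi).and key).exists
    have hs' : 0 < s := hs
    have hQs : Q s = 0 := (mul_eq_zero.mp hs0).resolve_right (by positivity)
    exact eq_of_integral_gaussianKernel_eq μ ν hs' ((gaussianKernel_energy μ ν hs'.le).2 hQs)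

/-- Borel measures on a subspace are determined by their images in the whole space, so strong negative
type passes to arbitrary (not necessarily measurable) subsets. -/
theorem StrongNegativeType.subset {X : Type*} [MetricSpace X] [SecondCountableTopology X]
    (h : StrongNegativeType X) (S : Set X) : StrongNegativeType S := by
  refine ⟨h.1.subset S, ?_⟩
  intro mS _ μ ν _ _ hμ hν
  borelize X
  have hv : Measurable (Subtype.val : S → X) := continuous_subtype_val.measurable
  have hfm : ∀ (ρ : Measure S) [IsProbabilityMeasure ρ], FiniteFirstMoment ρ →
      FiniteFirstMoment (ρ.map Subtype.val) := fun ρ _ hρ x => by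
    obtain ⟨o⟩ : Nonempty S := nonempty_of_isProbabilityMeasure ρ
    rw [integrable_map_measure (by fun_prop) hv.aemeasurable]
    refine ((integrable_const (dist x o)).add (hρ o)).mono'
      (by fun_prop) (Filter.Eventually.of_forall fun y => ?_)
    simp only [Function.comp_apply, Pi.add_apply]
    rw [Real.norm_of_nonneg dist_nonneg]
    exact dist_triangle x o y
  have hint : ∀ (ρ τ : Measure S) [IsProbabilityMeasure ρ] [IsProbabilityMeasure τ],
      ∫ x, ∫ y, dist x y ∂(τ.map Subtype.val) ∂(ρ.map Subtype.val) =
        ∫ x, ∫ y, dist x y ∂τ ∂ρ := fun ρ τ _ _ => by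
    have := Measure.isProbabilityMeasure_map (μ := τ) hv.aemeasurable
    rw [integral_map hv.aemeasurable]
    · congr 1
      funext x
      rw [integral_map hv.aemeasurable (by fun_prop)]
      rfl
    · refine (StronglyMeasurable.integral_prod_right ?_).aestronglyMeasurable
      exact continuous_dist.stronglyMeasurable
  have hen : energyIntegral (μ.map Subtype.val) (ν.map Subtype.val) = energyIntegral μ ν := by
    simp only [energyIntegral, hint]
  have := Measure.isProbabilityMeasure_map (μ := μ) hv.aemeasurable
  have := Measure.isProbabilityMeasure_map (μ := ν) hv.aemeasurable
  obtain ⟨h1, h2⟩ := h.2 _ _ (hfm μ hμ) (hfm ν hν)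
  rw [hen] at h1 h2
  refine ⟨h1, fun h0 => ?_⟩
  ext B hB
  obtain ⟨A, hA, rfl⟩ : ∃ A, MeasurableSet A ∧ Subtype.val ⁻¹' A = B := by
    have e : mS = (borel X).comap Subtype.val := by
      rw [BorelSpace.measurable_eq (α := S)]; exact borel_comap
    rw [e] at hB
    rwa [BorelSpace.measurable_eq (α := X)]
  rw [← Measure.map_apply hv hA, h2 h0, Measure.map_apply hv hA]

/-! ### Filtrations with prescribed bars in degree one -/

section Simplicial

variable (𝕜 : Type*) [Field 𝕜] {V : Type*} [LinearOrder V]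

@[simp]
theorem boundaryMap_single (s : Finset V) (a : 𝕜) :
    boundaryMap 𝕜 (Finsupp.single s a) = a • simplexBoundary 𝕜 s := by
  simp [boundaryMap]

theorem simplexBoundary_pair {u v : V} (h : u < v) :
    simplexBoundary 𝕜 {u, v} = Finsupp.single {v} 1 - Finsupp.single {u} 1 := by
  have e1 : ({u, v} : Finset V).erase u = {v} := by grind
  have e2 : ({u, v} : Finset V).erase v = {u} := by grind
  have c1 : ({u, v} : Finset V).filter (· < u) = ∅ := by grind
  have c2 : ({u, v} : Finset V).filter (· < v) = {u} := by grind
  rw [simplexBoundary, Finset.sum_pair h.ne, e1, e2, c1, c2]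
  simp [sub_eq_add_neg]

theorem simplexBoundary_triple {u v w : V} (h : u < v) (h' : v < w) :
    simplexBoundary 𝕜 {u, v, w} =
      Finsupp.single {v, w} 1 - Finsupp.single {u, w} 1 + Finsupp.single {u, v} 1 := by
  have e1 : ({u, v, w} : Finset V).erase u = {v, w} := by grind
  have e2 : ({u, v, w} : Finset V).erase v = {u, w} := by grind
  have e3 : ({u, v, w} : Finset V).erase w = {u, v} := by grind
  have c1 : ({u, v, w} : Finset V).filter (· < u) = ∅ := by grind
  have c2 : ({u, v, w} : Finset V).filter (· < v) = {u} := by grind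
  have c3 : ({u, v, w} : Finset V).filter (· < w) = {u, v} := by grind
  rw [simplexBoundary, Finset.sum_insert (by grind), Finset.sum_pair h'.ne, e1, e2, e3, c1, c2, c3,
    Finset.card_pair h.ne]
  simp [sub_eq_add_neg, add_assoc]

theorem boundaryMap_simplexBoundary_triple {u v w : V} (h : u < v) (h' : v < w) :
    boundaryMap 𝕜 (simplexBoundary 𝕜 {u, v, w}) = 0 := by
  rw [simplexBoundary_triple 𝕜 h h', map_add, map_sub]
  simp only [boundaryMap_single, one_smul]
  rw [simplexBoundary_pair 𝕜 h, simplexBoundary_pair 𝕜 h', simplexBoundary_pair 𝕜 (h.trans h')]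
  abel

/-- The cone operator with apex `o` on simplicial chains: it joins `o` to the simplices that do not
contain it and kills the others. If `o` is the least vertex, no signs are needed. -/
noncomputable def coneMap (o : V) : (Finset V →₀ 𝕜) →ₗ[𝕜] (Finset V →₀ 𝕜) :=
  Finsupp.linearCombination 𝕜 fun s => if o ∈ s then 0 else Finsupp.single (insert o s) 1

@[simp]
theorem coneMap_single (o : V) (s : Finset V) (a : 𝕜) :
    coneMap 𝕜 o (Finsupp.single s a) =
      a • (if o ∈ s then 0 else Finsupp.single (insert o s) 1) := by
  simp [coneMap]

/-- The cone operator is a contracting homotopy in degree one. -/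
theorem boundaryMap_coneMap_add {o : V} (ho : ∀ v, o ≤ v) {z : Finset V →₀ 𝕜}
    (hz : z ∈ Finsupp.supported 𝕜 𝕜 {s : Finset V | s.card = 2}) :
    boundaryMap 𝕜 (coneMap 𝕜 o z) + coneMap 𝕜 o (boundaryMap 𝕜 z) = z := by
  rw [Finsupp.supported_eq_span_single] at hz
  refine LinearMap.eqOn_span (f := boundaryMap 𝕜 ∘ₗ coneMap 𝕜 o + coneMap 𝕜 o ∘ₗ boundaryMap 𝕜)
    (g := LinearMap.id) ?_ hz
  rintro _ ⟨s, hs, rfl⟩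
  obtain ⟨x, y, hxy, rfl⟩ : ∃ x y, x < y ∧ s = {x, y} := by
    obtain ⟨x, y, hne, rfl⟩ := Finset.card_eq_two.mp hs
    rcases hne.lt_or_gt with h | h
    · exact ⟨x, y, h, rfl⟩
    · exact ⟨y, x, h, Finset.pair_comm x y⟩
  simp only [LinearMap.add_apply, LinearMap.comp_apply, LinearMap.id_apply, boundaryMap_single,
    coneMap_single, one_smul, simplexBoundary_pair 𝕜 hxy, map_sub, Finset.mem_singleton]
  have hy : o ≠ y := ((ho x).trans_lt hxy).ne
  rcases (ho x).eq_or_lt with rfl | hx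
  · simp [hy]
  · have : o ∉ ({x, y} : Finset V) := by simp [hx.ne, hy]
    rw [if_neg this, if_neg hx.ne, if_neg hy, boundaryMap_single, one_smul,
      simplexBoundary_triple 𝕜 hx hxy]
    abel

end Simplicial

/-- A quotient of coordinate subspaces, transported by an injective linear map, has the expected
dimension. -/
theorem rank_cyclesModBoundaries_map {𝕜 ι C : Type*} [Field 𝕜] [Fintype ι] [AddCommGroup C]
    [Module 𝕜 C] {T : (ι →₀ 𝕜) →ₗ[𝕜] C} (hT : Function.Injective T) (A D : Set ι) :
    Cardinal.toENat (Module.rank 𝕜 (CyclesModBoundaries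
      ((Finsupp.supported 𝕜 𝕜 A).map T) ((Finsupp.supported 𝕜 𝕜 D).map T))) = (A \ D).ncard := by
  classical
  set Z := (Finsupp.supported 𝕜 𝕜 A).map T
  set B := (Finsupp.supported 𝕜 𝕜 D).map T
  have hdim : ∀ S : Set ι, Module.finrank 𝕜 ((Finsupp.supported 𝕜 𝕜 S).map T) = S.ncard :=
    fun S => by
      rw [← (Submodule.equivMapOfInjective T hT _).finrank_eq,
        (Finsupp.supportedEquivFinsupp S).finrank_eq, Module.finrank_finsupp_self,
        Set.ncard_eq_toFinset_card', Set.toFinset_card]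
  have : Module.Finite 𝕜 Z := inferInstance
  have h1 := Submodule.finrank_quotient_add_finrank (B.submoduleOf Z)
  have h2 : Module.finrank 𝕜 (B.submoduleOf Z) = (A ∩ D).ncard := by
    rw [← hdim, Finsupp.supported_inter, Submodule.map_inf _ hT, ← Submodule.map_comap_subtype]
    exact (Submodule.equivMapOfInjective Z.subtype Z.injective_subtype _).finrank_eq
  have h3 := Set.ncard_inter_add_ncard_sdiff_eq_ncard A D
  rw [hdim, h2] at h1
  change Module.finrank 𝕜 (CyclesModBoundaries Z B) + _ = _ at h1
  rw [← Module.finrank_eq_rank, Cardinal.toENat_nat]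
  congr 1
  omega

section Bars

variable {N : ℕ}

/-- The `i`-th of `N` triangles that share the edge `{0, 1}`. -/
def bookTriangle (i : Fin N) : Finset (Fin (N + 2)) := {0, 1, i.succ.succ}

theorem one_lt_succ_succ (i : Fin N) : (1 : Fin (N + 2)) < i.succ.succ := by
  rw [Fin.lt_def]; simp

theorem card_bookTriangle (i : Fin N) : (bookTriangle i).card = 3 := by
  have := one_lt_succ_succ i
  rw [bookTriangle, Finset.card_eq_three]
  exact ⟨0, 1, i.succ.succ, by simp, (Fin.succ_ne_zero _).symm, this.ne, rfl⟩

/-- The filtration of the book of `N` triangles around the edge `{0, 1}`, in which the boundary of the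
`i`-th triangle appears at time `b i` and is filled at time `d i`. -/
def bookFiltration (b d : Fin N → ℝ) : ℝ →o PreAbstractSimplicialComplex (Fin (N + 2)) where
  toFun a :=
    { faces := {s | s.Nonempty ∧ (s ⊆ {0, 1} ∨
        ∃ i, s ⊆ bookTriangle i ∧ b i ≤ a ∧ (s = bookTriangle i → d i ≤ a))}
      isRelLowerSet_faces := by
        rintro s ⟨hs, h⟩
        refine ⟨hs, fun t hts ht => ⟨ht, ?_⟩⟩
        rcases h with h | ⟨i, hi, hb, hd⟩
        · exact Or.inl (hts.trans h)
        · exact Or.inr ⟨i, hts.trans hi, hb, fun e => hd (hi.antisymm (e ▸ hts))⟩ }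
  monotone' := by
    rintro a a' haa s ⟨hs, h⟩
    refine ⟨hs, h.imp_right ?_⟩
    rintro ⟨i, hi, hb, hd⟩
    exact ⟨i, hi, hb.trans haa, fun e => (hd e).trans haa⟩

/-- The triangles of the book at time `a` are the filled ones; their boundaries are present since
births precede deaths. -/
theorem mem_bookFiltration_card_three {b d : Fin N → ℝ} (hbd : ∀ i, b i < d i) {a : ℝ} :
    {s | s ∈ bookFiltration b d a ∧ s.card = 2 + 1} = bookTriangle '' {i | d i ≤ a} := by
  ext s
  constructor
  · rintro ⟨⟨-, h | ⟨i, hi, -, hd⟩⟩, hs⟩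
    · have := (Finset.card_le_card h).trans Finset.card_le_two
      omega
    · have := Finset.eq_of_subset_of_card_le hi (by rw [card_bookTriangle, hs])
      exact ⟨i, hd this, this.symm⟩
  · rintro ⟨i, hi, rfl⟩
    refine ⟨⟨?_, Or.inr ⟨i, subset_rfl, (hbd i).le.trans hi, fun _ => hi⟩⟩, card_bookTriangle i⟩
    exact Finset.card_pos.mp (by rw [card_bookTriangle]; norm_num)

/-- Every edge of the book that avoids the vertex `0` is opposite to `0` in one of the triangles. -/
theorem eq_of_mem_bookFiltration_card_two {b d : Fin N → ℝ} {a : ℝ} {s : Finset (Fin (N + 2))}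
    (hs : s ∈ bookFiltration b d a) (hs2 : s.card = 2) (h0 : 0 ∉ s) :
    ∃ i, b i ≤ a ∧ insert 0 s = bookTriangle i := by
  obtain ⟨-, h | ⟨i, hi, hb, -⟩⟩ := hs
  · have : s ⊆ {1} := by grind
    have := Finset.card_le_card this
    simp [hs2] at this
  · refine ⟨i, hb, Finset.eq_of_subset_of_card_le ?_ ?_⟩
    · exact Finset.insert_subset (by simp [bookTriangle]) hi
    · rw [Finset.card_insert_of_notMem h0, hs2, card_bookTriangle]

variable (𝕜 : Type*) [Field 𝕜]

/-- The linear map that sends the `i`-th basis vector to the boundary of the `i`-th triangle. -/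
noncomputable def bookCycle : (Fin N →₀ 𝕜) →ₗ[𝕜] (Finset (Fin (N + 2)) →₀ 𝕜) :=
  boundaryMap 𝕜 ∘ₗ Finsupp.lmapDomain 𝕜 𝕜 bookTriangle

theorem bookCycle_single (i : Fin N) (a : 𝕜) :
    bookCycle 𝕜 (Finsupp.single i a) = a • (Finsupp.single {1, i.succ.succ} 1 -
      Finsupp.single {0, i.succ.succ} 1 + Finsupp.single {0, 1} 1) := by
  simp only [bookCycle, LinearMap.comp_apply, Finsupp.lmapDomain_apply, Finsupp.mapDomain_single,
    boundaryMap_single]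
  rw [bookTriangle, simplexBoundary_triple 𝕜 (by simp) (one_lt_succ_succ i)]

theorem bookCycle_injective : Function.Injective (bookCycle 𝕜 : (Fin N →₀ 𝕜) →ₗ[𝕜] _) := by
  -- The coefficient of the edge opposite to `0` in the `i`-th triangle is the `i`-th coordinate.
  have h : ∀ i : Fin N, Finsupp.lapply {1, i.succ.succ} ∘ₗ bookCycle 𝕜 =
      (Finsupp.lapply i : (Fin N →₀ 𝕜) →ₗ[𝕜] 𝕜) := by
    intro i
    refine Finsupp.lhom_ext fun j a => ?_
    have h0 : ∀ x : Fin (N + 2), ({0, x} : Finset (Fin (N + 2))) ≠ {1, i.succ.succ} := by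
      intro x hx
      have : (0 : Fin (N + 2)) ∈ ({1, i.succ.succ} : Finset (Fin (N + 2))) := by
        rw [← hx]; simp
      simp [(Fin.succ_ne_zero _).symm] at this
    have h1 : ({1, j.succ.succ} : Finset (Fin (N + 2))) = {1, i.succ.succ} ↔ j = i := by
      constructor
      · intro hx
        have hj : j.succ.succ ∈ ({1, i.succ.succ} : Finset (Fin (N + 2))) := by
          rw [← hx]; simp
        simpa [(one_lt_succ_succ j).ne'] using hj
      · rintro rfl; rfl
    simp [bookCycle_single, Finsupp.single_apply, h0, h1]
  intro x y hxy
  ext i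
  have := congrArg (Finsupp.lapply (R := 𝕜) ({1, i.succ.succ} : Finset (Fin (N + 2)))) hxy
  rw [← LinearMap.comp_apply, ← LinearMap.comp_apply, h] at this
  simpa using this

theorem simplicialBoundaries_bookFiltration {b d : Fin N → ℝ} (hbd : ∀ i, b i < d i) (a : ℝ) :
    simplicialBoundaries 𝕜 (bookFiltration b d a) 1 =
      (Finsupp.supported 𝕜 𝕜 {i | d i ≤ a}).map (bookCycle 𝕜) := by
  rw [simplicialBoundaries, simplicialChains, mem_bookFiltration_card_three hbd, bookCycle,
    Submodule.map_comp, Finsupp.lmapDomain_supported]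

/-- By the cone homotopy, a cycle is the boundary of its cone with apex `0`, and the cone is a
combination of triangles whose boundaries have appeared. -/
theorem simplicialCycles_bookFiltration (b d : Fin N → ℝ) (a : ℝ) :
    simplicialCycles 𝕜 (bookFiltration b d a) 1 =
      (Finsupp.supported 𝕜 𝕜 {i | b i ≤ a}).map (bookCycle 𝕜) := by
  apply le_antisymm
  · rintro z ⟨hz, hker⟩
    have hz2 : z ∈ Finsupp.supported 𝕜 𝕜 {s : Finset (Fin (N + 2)) | s.card = 2} :=
      Finsupp.supported_mono (fun s hs => hs.2) hz
    have hcone := boundaryMap_coneMap_add 𝕜 (o := 0) (fun v => Fin.zero_le v) hz2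
    rw [LinearMap.mem_ker.mp hker, map_zero, add_zero] at hcone
    rw [← hcone, bookCycle, Submodule.map_comp, Finsupp.lmapDomain_supported]
    refine Submodule.mem_map_of_mem ?_
    rw [simplicialChains, Finsupp.supported_eq_span_single] at hz
    refine (Submodule.span_le (p := (Finsupp.supported 𝕜 𝕜 _).comap (coneMap 𝕜 0))).mpr ?_ hz
    rintro _ ⟨s, ⟨hs, hs2⟩, rfl⟩
    simp only [SetLike.mem_coe, Submodule.mem_comap, coneMap_single, one_smul]
    split_ifs with h0
    · exact zero_mem _
    · obtain ⟨i, hi, e⟩ := eq_of_mem_bookFiltration_card_two hs hs2 h0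
      rw [e]
      exact Finsupp.single_mem_supported 𝕜 1 ⟨i, hi, rfl⟩
  · rw [Finsupp.supported_eq_span_single, Submodule.map_span, Submodule.span_le]
    rintro _ ⟨_, ⟨i, hi, rfl⟩, rfl⟩
    have hw := one_lt_succ_succ i
    have hmem : ∀ x y : Fin (N + 2), x ≠ y → x ∈ bookTriangle i → y ∈ bookTriangle i →
        Finsupp.single {x, y} (1 : 𝕜) ∈ simplicialChains 𝕜 (bookFiltration b d a) 1 := by
      intro x y hxy hx hy
      refine Finsupp.single_mem_supported 𝕜 1 ⟨⟨by simp, Or.inr ⟨i, ?_, hi, fun e => ?_⟩⟩,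
        Finset.card_pair hxy⟩
      · simp [Finset.insert_subset_iff, hx, hy]
      · have := card_bookTriangle i
        rw [← e, Finset.card_pair hxy] at this
        omega
    constructor
    · rw [bookCycle_single, one_smul]
      refine add_mem (sub_mem (hmem _ _ hw.ne ?_ ?_) (hmem _ _ (Fin.succ_ne_zero _).symm ?_ ?_))
        (hmem _ _ (by simp) ?_ ?_) <;> simp [bookTriangle]
    · rw [SetLike.mem_coe, LinearMap.mem_ker]
      simp only [bookCycle, LinearMap.comp_apply, Finsupp.lmapDomain_apply,
        Finsupp.mapDomain_single, boundaryMap_single, one_smul]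
      exact boundaryMap_simplexBoundary_triple 𝕜 (by simp) hw

/-- The persistent Betti number of the book filtration in degree one counts the bars `[b i, d i)`
that contain both parameters. -/
theorem persistentBetti_bookFiltration {b d : Fin N → ℝ} (hbd : ∀ i, b i < d i) (a c : ℝ) :
    persistentBetti 𝕜 (bookFiltration b d) 1 a c =
      ((Finset.univ.filter fun i => b i ≤ a ∧ c < d i).card : ℕ∞) := by
  change Cardinal.toENat (Module.rank 𝕜 (CyclesModBoundaries
    (simplicialCycles 𝕜 (bookFiltration b d a) 1)
    (simplicialBoundaries 𝕜 (bookFiltration b d c) 1))) = _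
  rw [simplicialCycles_bookFiltration,
    simplicialBoundaries_bookFiltration 𝕜 hbd,
    rank_cyclesModBoundaries_map (bookCycle_injective 𝕜), ← Set.ncard_coe_finset]
  congr 2
  ext i
  simp

end Bars

/-! ### Landscapes of nested bars -/

/-- The sequence `h 0 ≥ h 1 ≥ …` has exactly `N` positive terms and is zero afterwards. It encodes
the persistence diagram of the nested bars `[-h i, h i)`, `i < N`. -/
structure IsHeightSequence (N : ℕ) (h : ℕ → ℝ) : Prop where
  antitone : Antitone h
  pos : ∀ i < N, 0 < h i
  eq_zero : ∀ i, N ≤ i → h i = 0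

/-- The sequence of centred tents of the given heights, as a function on `ℕ × ℝ`. -/
def tents (h : ℕ → ℝ) (x : ℕ × ℝ) : ℝ := max (h x.1 - |x.2|) 0

namespace IsHeightSequence

variable {N : ℕ} {h : ℕ → ℝ}

/-- The persistence diagram of the nested bars `[-h i, h i)`. -/
def diagram (hh : IsHeightSequence N h) : PersistenceDiagram where
  points := (Finset.univ : Finset (Fin N)).val.map fun i : Fin N => (-h i, h i)
  birth_lt_death := by
    simp only [Multiset.mem_map, Finset.mem_val, Finset.mem_univ, true_and]
    rintro _ ⟨i, rfl⟩
    have := hh.pos i i.2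
    simp only
    linarith

/-- A filtration with the nested bars `[-h i, h i)` in degree one. -/
def filtration (_ : IsHeightSequence N h) : ℝ →o PreAbstractSimplicialComplex (Fin (N + 2)) :=
  bookFiltration (fun i => -h i) fun i => h i

variable (hh : IsHeightSequence N h) (𝕜 : Type*) [Field 𝕜]

theorem persistentBetti_filtration (a c : ℝ) : persistentBetti 𝕜 hh.filtration 1 a c =
    (((Finset.univ : Finset (Fin N)).filter fun i : Fin N => -h i ≤ a ∧ c < h i).card : ℕ∞) :=
  persistentBetti_bookFiltration 𝕜 (fun i : Fin N => by have := hh.pos i i.2; linarith) a c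

theorem isPersistenceDiagramOf : IsPersistenceDiagramOf hh.diagram 𝕜 hh.filtration 1 := by
  intro a c _
  rw [hh.persistentBetti_filtration]
  simp only [diagram, Multiset.countP_map]
  congr!

theorem le_persistentBetti_filtration_iff (k : ℕ) (t : ℝ) (m : ℝ≥0) :
    ((k + 1 : ℕ) : ℕ∞) ≤ persistentBetti 𝕜 hh.filtration 1 (t - m) (t + m) ↔
      m ≤ h k + t ∧ m < h k - t := by
  rw [hh.persistentBetti_filtration, Nat.cast_le]
  constructor
  · intro hk
    -- Fewer than `k + 1` bars precede the `k`-th one, so some bar with `k ≤ i` is counted.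
    obtain ⟨i, hi, hik⟩ : ∃ i ∈ (Finset.univ : Finset (Fin N)).filter
        (fun i : Fin N => -h i ≤ t - m ∧ t + m < h i), k ≤ (i : ℕ) := by
      by_contra! hcon
      have h1 : ((Finset.univ : Finset (Fin N)).filter
          (fun i : Fin N => -h i ≤ t - m ∧ t + m < h i)).card ≤ (Finset.range k).card :=
        Finset.card_le_card_of_injOn (fun i : Fin N => (i : ℕ))
          (fun i hi => by simpa using hcon i hi) (fun i _ j _ hij => Fin.ext hij)
      rw [Finset.card_range] at h1
      omega
    have := hh.antitone hik
    simp only [Finset.mem_filter, Finset.mem_univ, true_and] at hi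
    constructor <;> linarith
  · rintro ⟨h1, h2⟩
    have hkN : k < N := by
      by_contra! hkN
      rw [hh.eq_zero k hkN] at h1 h2
      linarith [m.2]
    calc k + 1 = (Finset.Iic (⟨k, hkN⟩ : Fin N)).card := by simp
      _ ≤ _ := Finset.card_le_card fun i hi => by
        have := hh.antitone (show (i : ℕ) ≤ k from Fin.le_def.mp (Finset.mem_Iic.mp hi))
        simp only [Finset.mem_filter, Finset.mem_univ, true_and]
        constructor <;> linarith

/-- The landscape functions of the nested bars are the tents of the corresponding heights. -/
theorem persistenceLandscape_filtration (k : ℕ) (t : ℝ) :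
    persistenceLandscape 𝕜 hh.filtration 1 (k + 1) t = ENNReal.ofReal (tents h (k, t)) := by
  simp only [persistenceLandscape, hh.le_persistentBetti_filtration_iff, tents]
  apply le_antisymm
  · refine iSup₂_le fun m hm => ?_
    rw [← ENNReal.ofReal_coe_nnreal]
    refine ENNReal.ofReal_le_ofReal (le_max_of_le_left ?_)
    rcases abs_cases t with ⟨e, _⟩ | ⟨e, _⟩ <;> rw [e] <;> linarith [hm.1, hm.2]
  · refine ENNReal.le_of_forall_nnreal_lt fun m hm => ?_
    refine le_iSup₂_of_le m ?_ le_rfl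
    rw [← ENNReal.ofReal_coe_nnreal, ENNReal.ofReal_lt_ofReal_iff_of_nonneg m.coe_nonneg,
      lt_max_iff, or_iff_left m.coe_nonneg.not_gt] at hm
    have := neg_abs_le t
    have := le_abs_self t
    constructor <;> linarith

theorem memLp_tents (hh : IsHeightSequence N h) (p : ℝ≥0∞) :
    MemLp (tents h) p ((Measure.count : Measure ℕ).prod (volume : Measure ℝ)) := by
  have hc : Continuous (tents h) := by
    have : Continuous fun x : ℕ × ℝ => h x.1 := continuous_of_discreteTopology.comp continuous_fst
    unfold tents
    fun_prop
  have : IsFiniteMeasureOnCompacts (Measure.count : Measure ℕ) :=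
    ⟨fun K hK => Measure.count_apply_lt_top.mpr hK.finite_of_discrete⟩
  refine hc.memLp_of_hasCompactSupport ?_
  refine HasCompactSupport.intro (K := (Finset.range N : Set ℕ) ×ˢ Set.Icc (-h 0) (h 0))
    ((Finset.range N).finite_toSet.isCompact.prod isCompact_Icc) fun x hx => ?_
  refine max_eq_right ?_
  by_contra! hpos
  refine hx ⟨?_, ?_⟩
  · simp only [Finset.coe_range, Set.mem_Iio]
    by_contra! hN
    rw [hh.eq_zero _ hN] at hpos
    linarith [abs_nonneg x.2]
  · have := hh.antitone (Nat.zero_le x.1)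
    have : |x.2| ≤ h 0 := by linarith
    exact abs_le.mp this

/-- The landscape of the nested bars as an element of `L^p`. -/
noncomputable def landscape (hh : IsHeightSequence N h) (p : ℝ≥0∞) : LandscapeFunctionSpace p :=
  (hh.memLp_tents p).toLp

theorem coeFn_landscape (p : ℝ≥0∞) :
    hh.landscape p =ᵐ[(Measure.count : Measure ℕ).prod (volume : Measure ℝ)] tents h :=
  MemLp.coeFn_toLp _

theorem landscape_mem_diagramLandscapes (p : ℝ≥0∞) : hh.landscape p ∈ diagramLandscapes 𝕜 p := by
  refine ⟨Fin (N + 2), inferInstance, inferInstance, hh.filtration, 1, hh.diagram,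
    hh.isPersistenceDiagramOf 𝕜, ?_⟩
  filter_upwards [hh.coeFn_landscape p] with x hx
  rw [hx, hh.persistenceLandscape_filtration 𝕜, EReal.coe_ennreal_ofReal,
    max_eq_left (show (0 : ℝ) ≤ tents h (x.1, x.2) from le_max_right _ _)]

end IsHeightSequence

theorem diagramLandscapes_subset (𝕜 : Type*) [Field 𝕜] (p : ℝ≥0∞) :
    diagramLandscapes 𝕜 p ⊆ landscapes 𝕜 p := by
  rintro f ⟨V, _, _, K, n, _, -, hf⟩
  exact ⟨V, _, K, n, hf⟩

/-- The distance of two landscapes in the supremum norm is at least the difference of heights of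
each pair of tents, since it is attained near the common centre. -/
theorem abs_sub_le_dist_landscape {N : ℕ} {h h' : ℕ → ℝ} (hh : IsHeightSequence N h)
    (hh' : IsHeightSequence N h') (k : ℕ) :
    |h k - h' k| ≤ dist (hh.landscape ∞) (hh'.landscape ∞) := by
  rcases lt_or_ge k N with hk | hk
  · by_contra! hlt
    set ε := min (h k) (h' k)
    have hε : 0 < ε := lt_min (hh.pos k hk) (hh'.pos k hk)
    have hae : ∀ᵐ x ∂((Measure.count : Measure ℕ).prod (volume : Measure ℝ)),
        x ∉ ({k} : Set ℕ) ×ˢ Set.Ioo (-ε) ε := by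
      have hsub := (Lp.memLp (hh.landscape ∞)).sub (Lp.memLp (hh'.landscape ∞))
      filter_upwards [hh.coeFn_landscape ∞, hh'.coeFn_landscape ∞,
        ae_le_eLpNormEssSup (f := ⇑(hh.landscape ∞) - ⇑(hh'.landscape ∞))] with x h1 h2 h3 hx
      obtain ⟨hxk, hxε⟩ := hx
      have hxk : x.1 = k := hxk
      have hxε : |x.2| < ε := abs_lt.mpr hxε
      have e : ‖(⇑(hh.landscape ∞) - ⇑(hh'.landscape ∞)) x‖ = |h k - h' k| := by
        rw [Pi.sub_apply, h1, h2, tents, tents, hxk,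
          max_eq_left (by linarith [min_le_left (h k) (h' k)]),
          max_eq_left (by linarith [min_le_right (h k) (h' k)]), Real.norm_eq_abs]
        congr 1; ring
      rw [Lp.dist_def, ← e, eLpNorm_exponent_top] at hlt
      have hfin : eLpNormEssSup (⇑(hh.landscape ∞) - ⇑(hh'.landscape ∞))
          ((Measure.count : Measure ℕ).prod (volume : Measure ℝ)) ≠ ∞ := by
        have := hsub.eLpNorm_ne_top
        rwa [eLpNorm_exponent_top] at this
      have := ENNReal.toReal_mono hfin h3
      rw [toReal_enorm] at this
      linarith
    have h0 := measure_eq_zero_iff_ae_notMem.mpr hae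
    rw [Measure.prod_prod, Measure.count_singleton, one_mul, Real.volume_Ioo,
      ENNReal.ofReal_eq_zero] at h0
    linarith
  · rw [hh.eq_zero k hk, hh'.eq_zero k hk]; simp

theorem dist_landscape_le {N : ℕ} {h h' : ℕ → ℝ} (hh : IsHeightSequence N h)
    (hh' : IsHeightSequence N h') {C : ℝ} (hC : ∀ k, |h k - h' k| ≤ C) :
    dist (hh.landscape ∞) (hh'.landscape ∞) ≤ C := by
  have hC0 : 0 ≤ C := (abs_nonneg _).trans (hC 0)
  rw [Lp.dist_def, eLpNorm_exponent_top]
  refine ENNReal.toReal_le_of_le_ofReal hC0 (eLpNormEssSup_le_of_ae_bound ?_)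
  filter_upwards [hh.coeFn_landscape ∞, hh'.coeFn_landscape ∞] with x h1 h2
  rw [Pi.sub_apply, h1, h2, Real.norm_eq_abs, tents, tents]
  refine (abs_max_sub_max_le_abs _ _ _).trans ?_
  simpa using hC x.1

/-- If at each index the heights of the first two landscapes are those of the last two, in some
order, then the four `L^1` distances between the pairs add up to those within the pairs. -/
theorem dist_landscape_add_dist_landscape {N : ℕ} {a b c d : ℕ → ℝ} (ha : IsHeightSequence N a)
    (hb : IsHeightSequence N b) (hc : IsHeightSequence N c) (hd : IsHeightSequence N d)
    (h : ∀ k, (a k = c k ∧ b k = d k) ∨ (a k = d k ∧ b k = c k)) :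
    dist (ha.landscape 1) (hb.landscape 1) + dist (hc.landscape 1) (hd.landscape 1) =
      dist (ha.landscape 1) (hc.landscape 1) + dist (ha.landscape 1) (hd.landscape 1) +
      (dist (hb.landscape 1) (hc.landscape 1) + dist (hb.landscape 1) (hd.landscape 1)) := by
  have hi : ∀ f g : LandscapeFunctionSpace 1, Integrable (fun x => |f x - g x|)
      ((Measure.count : Measure ℕ).prod (volume : Measure ℝ)) := fun f g =>
    ((L1.integrable_coeFn f).sub (L1.integrable_coeFn g)).abs
  have hdist : ∀ f g : LandscapeFunctionSpace 1, dist f g = ∫ x, |f x - g x|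
      ∂((Measure.count : Measure ℕ).prod (volume : Measure ℝ)) := fun f g => by
    simp [Lp_dist_eq_integral one_ne_zero ENNReal.one_ne_top]
  simp only [hdist]
  rw [← integral_add' (hi _ _) (hi _ _), ← integral_add' (hi _ _) (hi _ _),
    ← integral_add' (hi _ _) (hi _ _),
    ← integral_add' ((hi _ _).add (hi _ _)) ((hi _ _).add (hi _ _))]
  refine integral_congr_ae ?_
  filter_upwards [ha.coeFn_landscape 1, hb.coeFn_landscape 1, hc.coeFn_landscape 1,
    hd.coeFn_landscape 1] with x h1 h2 h3 h4
  simp only [Pi.add_apply, h1, h2, h3, h4, tents]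
  rcases h x.1 with ⟨e1, e2⟩ | ⟨e1, e2⟩ <;> rw [e1, e2] <;>
    simp [abs_sub_comm]

/-! ### Failure of (strong) negative type -/

/-- Two pairs of points whose mutual distances add up to the distances within the pairs are an
obstruction to strong negative type: the uniform measures on the pairs have energy zero. -/
theorem not_strongNegativeType {X : Type*} [MetricSpace X] {a b c d : X} (hac : a ≠ c) (had : a ≠ d)
    (h : dist a b + dist c d = dist a c + dist a d + (dist b c + dist b d)) :
    ¬ StrongNegativeType X := by
  rintro ⟨-, hs⟩
  borelize X
  obtain ⟨m, hm⟩ : ∃ m : X → X → Measure X, ∀ x y, m x y =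
      (2⁻¹ : ℝ≥0∞) • Measure.dirac x + (2⁻¹ : ℝ≥0∞) • Measure.dirac y := ⟨_, fun _ _ => rfl⟩
  have hprob : ∀ x y, IsProbabilityMeasure (m x y) := fun x y =>
    ⟨by simp [hm, ENNReal.inv_two_add_inv_two]⟩
  have hi : ∀ (f : X → ℝ) (x : X), Integrable f ((2⁻¹ : ℝ≥0∞) • Measure.dirac x) := fun f x =>
    (integrable_dirac (by simp)).smul_measure (by simp)
  have hint : ∀ (f : X → ℝ) (x y : X), ∫ z, f z ∂(m x y) = 2⁻¹ * f x + 2⁻¹ * f y := fun f x y => by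
    rw [hm, integral_add_measure (hi f x) (hi f y), integral_smul_measure, integral_smul_measure,
      integral_dirac, integral_dirac]
    simp
  have hfm : ∀ x y, FiniteFirstMoment (m x y) := fun x y o => by
    rw [hm]; exact (hi _ _).add_measure (hi _ _)
  have heq := (hs (m a b) (m c d) (hfm a b) (hfm c d)).2 (by
    simp only [energyIntegral, hint, dist_self, dist_comm b a, dist_comm d c, dist_comm c a,
      dist_comm d a, dist_comm c b, dist_comm d b]
    linarith)
  have := congrArg (fun ρ => ρ {a}) heq
  simp [hm, hac.symm, had.symm, Set.indicator] at this

/-- The complete bipartite graph on `2 + 3` vertices, with its path metric, is not of negative type;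
the weights `3` and `-2` on the two parts show this. Only inequalities between the distances are
needed. -/
theorem not_negativeType {X : Type*} [MetricSpace X] {x y u v w : X} (hxy : 2 ≤ dist x y)
    (huv : 2 ≤ dist u v) (huw : 2 ≤ dist u w) (hvw : 2 ≤ dist v w)
    (hxu : dist x u ≤ 1) (hxv : dist x v ≤ 1) (hxw : dist x w ≤ 1)
    (hyu : dist y u ≤ 1) (hyv : dist y v ≤ 1) (hyw : dist y w ≤ 1) :
    ¬ NegativeType X := by
  intro hn
  have h := hn 5 ![x, y, u, v, w] ![3, 3, -2, -2, -2] (by simp [Fin.sum_univ_succ]; norm_num)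
  simp [Fin.sum_univ_succ, dist_comm y x, dist_comm u x, dist_comm v x, dist_comm w x,
    dist_comm u y, dist_comm v y, dist_comm w y, dist_comm v u, dist_comm w u, dist_comm w v] at h
  linarith

/-- The sequence `x, y, z, 0, 0, …` -/
def threeHeights (x y z : ℝ) : ℕ → ℝ
  | 0 => x
  | 1 => y
  | 2 => z
  | _ => 0

theorem isHeightSequence_threeHeights {x y z : ℝ} (hz : 0 < z) (hzy : z ≤ y) (hyx : y ≤ x) :
    IsHeightSequence 3 (threeHeights x y z) where
  antitone := antitone_nat_of_succ_le fun n => by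
    rcases n with _ | _ | _ | n <;> simp only [threeHeights] <;> linarith
  pos i hi := by
    interval_cases i <;> simp only [threeHeights] <;> linarith
  eq_zero i hi := by
    obtain ⟨j, rfl⟩ := Nat.exists_eq_add_of_le' hi
    rfl

theorem abs_threeHeights_sub_le {x y z x' y' z' C : ℝ} (hx : |x - x'| ≤ C) (hy : |y - y'| ≤ C)
    (hz : |z - z'| ≤ C) (k : ℕ) : |threeHeights x y z k - threeHeights x' y' z' k| ≤ C := by
  rcases k with _ | _ | _ | k
  · exact hx
  · exact hy
  · exact hz
  · simpa [threeHeights] using (abs_nonneg _).trans hx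

theorem landscape_ne {N : ℕ} {h h' : ℕ → ℝ} (hh : IsHeightSequence N h)
    (hh' : IsHeightSequence N h') {k : ℕ} (hk : h k ≠ h' k) {p : ℝ≥0∞} :
    hh.landscape p ≠ hh'.landscape p := by
  intro e
  have hae : tents h =ᵐ[(Measure.count : Measure ℕ).prod (volume : Measure ℝ)] tents h' :=
    (hh.coeFn_landscape p).symm.trans (e ▸ hh'.coeFn_landscape p)
  have h2 : hh.landscape ∞ = hh'.landscape ∞ :=
    MemLp.toLp_congr _ _ hae
  have := abs_sub_le_dist_landscape hh hh' k
  rw [h2, dist_self] at this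
  exact hk (sub_eq_zero.mp (abs_nonpos_iff.mp this))

/-- A subset of `L^1` that contains the landscapes of persistence diagrams contains four landscapes
that form a rectangle: two of the heights vary independently. -/
theorem not_strongNegativeType_of_diagramLandscapes_subset (𝕜 : Type*) [Field 𝕜]
    {S : Set (LandscapeFunctionSpace 1)} (hS : diagramLandscapes 𝕜 1 ⊆ S) :
    ¬ StrongNegativeType S := by
  have hh : ∀ i j : ℝ, 0 ≤ i → i ≤ 1 → 0 ≤ j → j ≤ 1 →
      IsHeightSequence 3 (threeHeights (4 + i) (2 + j) 1) := fun i j hi hi' hj hj' =>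
    isHeightSequence_threeHeights one_pos (by linarith) (by linarith)
  have ha := hh 0 0 le_rfl zero_le_one le_rfl zero_le_one
  have hb := hh 1 1 zero_le_one le_rfl zero_le_one le_rfl
  have hc := hh 1 0 zero_le_one le_rfl le_rfl zero_le_one
  have hd := hh 0 1 le_rfl zero_le_one zero_le_one le_rfl
  refine not_strongNegativeType (X := S)
    (a := ⟨_, hS (ha.landscape_mem_diagramLandscapes 𝕜 1)⟩)
    (b := ⟨_, hS (hb.landscape_mem_diagramLandscapes 𝕜 1)⟩)
    (c := ⟨_, hS (hc.landscape_mem_diagramLandscapes 𝕜 1)⟩)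
    (d := ⟨_, hS (hd.landscape_mem_diagramLandscapes 𝕜 1)⟩) ?_ ?_ ?_
  · rw [Ne, Subtype.mk.injEq]
    exact landscape_ne ha hc (k := 0) (by simp [threeHeights])
  · rw [Ne, Subtype.mk.injEq]
    exact landscape_ne ha hd (k := 1) (by simp [threeHeights])
  · refine dist_landscape_add_dist_landscape ha hb hc hd fun k => ?_
    rcases k with _ | _ | _ | k <;> simp [threeHeights]

/-- A subset of `L^∞` that contains the landscapes of persistence diagrams contains isometric copies
of cubes in the supremum norm, hence one of the complete bipartite graph on `2 + 3` vertices: the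
first part lies on the axis of the third coordinate, the second part consists of vertices of the
square of the first two coordinates. -/
theorem not_negativeType_of_diagramLandscapes_subset (𝕜 : Type*) [Field 𝕜]
    {S : Set (LandscapeFunctionSpace ∞)} (hS : diagramLandscapes 𝕜 ∞ ⊆ S) :
    ¬ NegativeType S := by
  have hh : ∀ i j k : ℝ, |i| ≤ 1 → |j| ≤ 1 → |k| ≤ 1 →
      IsHeightSequence 3 (threeHeights (8 + i) (5 + j) (2 + k)) := fun i j k hi hj hk => by
    rw [abs_le] at hi hj hk
    exact isHeightSequence_threeHeights (by linarith) (by linarith) (by linarith)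
  have hx := hh 0 0 1 (by simp) (by simp) (by simp)
  have hy := hh 0 0 (-1) (by simp) (by simp) (by simp)
  have hu := hh 1 1 0 (by simp) (by simp) (by simp)
  have hv := hh 1 (-1) 0 (by simp) (by simp) (by simp)
  have hw := hh (-1) 1 0 (by simp) (by simp) (by simp)
  refine not_negativeType (X := S)
    (x := ⟨_, hS (hx.landscape_mem_diagramLandscapes 𝕜 ∞)⟩)
    (y := ⟨_, hS (hy.landscape_mem_diagramLandscapes 𝕜 ∞)⟩)
    (u := ⟨_, hS (hu.landscape_mem_diagramLandscapes 𝕜 ∞)⟩)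
    (v := ⟨_, hS (hv.landscape_mem_diagramLandscapes 𝕜 ∞)⟩)
    (w := ⟨_, hS (hw.landscape_mem_diagramLandscapes 𝕜 ∞)⟩) ?_ ?_ ?_ ?_ ?_ ?_ ?_ ?_ ?_ ?_
  · refine le_trans ?_ (abs_sub_le_dist_landscape hx hy 2)
    norm_num [threeHeights]
  · refine le_trans ?_ (abs_sub_le_dist_landscape hu hv 1)
    norm_num [threeHeights]
  · refine le_trans ?_ (abs_sub_le_dist_landscape hu hw 0)
    norm_num [threeHeights]
  · refine le_trans ?_ (abs_sub_le_dist_landscape hv hw 0)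
    norm_num [threeHeights]
  · exact dist_landscape_le hx hu (abs_threeHeights_sub_le (by simp) (by simp) (by simp))
  · exact dist_landscape_le hx hv (abs_threeHeights_sub_le (by simp) (by simp) (by simp))
  · exact dist_landscape_le hx hw (abs_threeHeights_sub_le (by simp) (by simp) (by simp))
  · exact dist_landscape_le hy hu (abs_threeHeights_sub_le (by simp) (by simp) (by simp))
  · exact dist_landscape_le hy hv (abs_threeHeights_sub_le (by simp) (by simp) (by simp))
  · exact dist_landscape_le hy hw (abs_threeHeights_sub_le (by simp) (by simp) (by simp))

/-! ### Spaces of persistence landscapes -/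

/-- Each part is stated for the whole function space `L^p(ℕ × ℝ)` and for the set of those of its
elements that are persistence landscapes of filtrations; the negative parts also for the landscapes
that arise from persistence diagrams. -/
theorem theorem3p2 (𝕜 : Type*) [Field 𝕜] :
    (StrongNegativeType (LandscapeFunctionSpace 2) ∧
      StrongNegativeType (landscapes 𝕜 2)) ∧
    (∀ (p : ℝ≥0∞) [Fact (1 ≤ p)], p ≤ 2 →
      NegativeType (LandscapeFunctionSpace p) ∧ NegativeType (landscapes 𝕜 p)) ∧
    (¬ StrongNegativeType (LandscapeFunctionSpace 1) ∧
      ¬ StrongNegativeType (landscapes 𝕜 1) ∧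
      ¬ StrongNegativeType (diagramLandscapes 𝕜 1)) ∧
    (¬ NegativeType (LandscapeFunctionSpace ∞) ∧
      ¬ NegativeType (landscapes 𝕜 ∞) ∧
      ¬ NegativeType (diagramLandscapes 𝕜 ∞)) := by
  have : Fact ((2 : ℝ≥0∞) ≠ ∞) := ⟨by simp⟩
  have h2 : StrongNegativeType (LandscapeFunctionSpace 2) :=
    strongNegativeType_of_innerProductSpace
  refine ⟨⟨h2, h2.subset _⟩, fun p _ hp => ⟨negativeType_Lp hp, (negativeType_Lp hp).subset _⟩,
    ⟨fun h => ?_, ?_, ?_⟩, ⟨fun h => ?_, ?_, ?_⟩⟩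
  · have : Fact ((1 : ℝ≥0∞) ≠ ∞) := ⟨by simp⟩
    exact not_strongNegativeType_of_diagramLandscapes_subset 𝕜 (Set.subset_univ _) (h.subset _)
  · exact not_strongNegativeType_of_diagramLandscapes_subset 𝕜 (diagramLandscapes_subset 𝕜 1)
  · exact not_strongNegativeType_of_diagramLandscapes_subset 𝕜 subset_rfl
  · exact not_negativeType_of_diagramLandscapes_subset 𝕜 (Set.subset_univ _) (h.subset _)
  · exact not_negativeType_of_diagramLandscapes_subset 𝕜 (diagramLandscapes_subset 𝕜 ∞)
  · exact not_negativeType_of_diagramLandscapes_subset 𝕜 subset_rfl
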